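/- **Setting.** Clients $i=1,\dots,M$ hold data $(x_{ij},y_{ij})$, $1\le j\le n_i$, $n_i\ge 1$, and $N=\sum_i n_i$, $w_i=n_i/N$. Let $\phi:\mathcal X\to\mathbb R^d$ be a feature map, $k(a,b)=\langle\phi(a),\phi(b)\rangle$, and let functions $f=\langle\phi,\theta\rangle$ be identified with their coefficients $\theta\in\mathbb R^d$ (Euclidean norm). The responses are $y_{ij}=\langle\phi(x_{ij}),\theta_i^*\rangle+\xi_{ij}$ with independent zero-mean noises $\xi_{ij}$ of variance at most $\sigma^2$; $\mathbb E_\xi$ is the expectation over the noise with the covariates fixed. Let $\ell_i(\theta)=\frac1{2n_i}\sum_j(\langle\phi(x_{ij}),\theta\rangle-y_{ij})^2$ and $\eta>0$. From $\theta_0$, the global model is $\theta_t=\sum_i w_i\theta_{i,t}$, where, for FedAvg, $\theta_{i,t}$ results from $\theta_{t-1}$ by $s\ge1$ gradient steps $\theta\mapsto\theta-\eta\nabla\ell_i(\theta)$ and, for FedProx (where we put $s=1$), $\theta_{i,t}=\arg\min_\theta\ \ell_i(\theta)+\frac1{2\eta}\|\theta-\theta_{t-1}\|^2$. Put $C_i=\frac1{n_i}\sum_j\phi(x_{ij})\phi(x_{ij})^\top$.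 Let $\mathcal L=\sum_i w_i(I-\eta C_i)^s$ and $\Psi_{ij}=\frac{\eta}{n_i}\sum_{\tau<s}(I-\eta C_i)^\tau\phi(x_{ij})$ for FedAvg, and $\mathcal L=\sum_i w_i(I+\eta C_i)^{-1}$ and $\Psi_{ij}=\frac{\eta}{n_i}(I+\eta C_i)^{-1}\phi(x_{ij})$ for FedProx. When $I-\mathcal L$ is invertible, let $$\bar\theta=(I-\mathcal L)^{-1}\sum_i w_i\sum_j\langle\phi(x_{ij}),\theta_i^*\rangle\Psi_{ij}.$$ Let $\gamma=\eta\max_i\|K_i\|$, where $K_i$ is the matrix with entries $k(x_{ij},x_{il})/n_i$ and $\|\cdot\|$ is the spectral norm, let $\kappa=\frac{\gamma s}{1-(1-\gamma)^s}$ for FedAvg and $\kappa=1+\gamma$ for FedProx, and let $\Gamma=\max_{i,j}\|\theta_i^*-\theta_j^*\|$. **Statement.** Let $\alpha,\beta,K>0$. There are constants $c_1,c_2,c_3>0$ depending only on $\alpha,\beta,K$ such that the following holds. Suppose that the random feature vectors $\phi(x_{ij})$ are independent and sub-Gaussian with norm at most $K$ (that is, $\mathbb E\exp(\langle u,\phi(x_{ij})\rangle^2/K^2)\le2$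 for all unit vectors $u$), that $\alpha I\preceq\mathbb E[\phi(x_{ij})\phi(x_{ij})^\top]\preceq\beta I$ for all $i,j$, and that $N\ge c_1d$. Then there are events $E,E'$ of the covariates with $$\mathbb P(E)\ge1-e^{-d},\qquad \mathbb P(E)\ge 1-e^{-c_3N},\qquad \mathbb P(E')\ge1-e^{-N},$$ such that for both algorithms, every $\eta>0$ and $s\ge1$ (in the case of FedAvg provided that $\gamma<1$): 1. on $E$, the operator $I-\mathcal L$ is invertible and, for all $\theta_0$, all $t\ge0$, all $\sigma$ and all noise distributions as above, $$\mathbb E_\xi\|\theta_t-\bar\theta\|^2\le\Bigl(1-\frac{s\eta\alpha}{2\kappa}\Bigr)^{2t}\|\theta_0-\bar\theta\|^2+\sigma^2\,\frac{2\kappa d}{N\alpha};$$ 2. on $E\cap E'$, for all $j$, $$\|\bar\theta-\theta_j^*\|\le c_2\,\Gamma\sqrt{\kappa}.$$ -/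

import Mathlib

open MeasureTheory ProbabilityTheory

noncomputable section

namespace FedLearn

/-- Model coefficients: `ℝ^d` with the Euclidean norm. -/
abbrev Coef (d : ℕ) : Type := EuclideanSpace ℝ (Fin d)

/-- The two training algorithms. `fedAvg s` runs `s` local gradient steps per round;
`fedProx` solves one proximal problem per round. -/
inductive FLAlgorithm where
  | fedAvg (s : ℕ) : FLAlgorithm
  | fedProx : FLAlgorithm

/-- The parameter `s`: the number of local steps of FedAvg; `s = 1` for FedProx. -/
def FLAlgorithm.steps : FLAlgorithm → ℕ
  | .fedAvg s => s
  | .fedProx => 1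

section Client

variable {𝒳 : Type*} {d m : ℕ}

/-- The function `f = ⟨φ, θ⟩` with coefficient `θ`, evaluated at `a`. -/
def modelValue (φ : 𝒳 → Coef d) (θ : Coef d) (a : 𝒳) : ℝ := inner ℝ (φ a) θ

/-- The kernel `k(a, b) = ⟨φ(a), φ(b)⟩`. -/
def kern (φ : 𝒳 → Coef d) (a b : 𝒳) : ℝ := inner ℝ (φ a) (φ b)

/-- The normalized Gram matrix `K_x` of the `m` points `x`, with entries `k(x_a, x_b) / m`. -/
def gram (φ : 𝒳 → Coef d) (x : Fin m → 𝒳) : Matrix (Fin m) (Fin m) ℝ :=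
  Matrix.of fun a b => kern φ (x a) (x b) / m

/-- The empirical risk `(1 / (2m)) ∑ j, (f(x_j) - y_j)²` of a client, as a function of the
coefficient of `f`. -/
def localRisk (φ : 𝒳 → Coef d) (x : Fin m → 𝒳) (y : Fin m → ℝ) (θ : Coef d) : ℝ :=
  1 / (2 * (m : ℝ)) * ∑ j, (modelValue φ θ (x j) - y j) ^ 2

/-- The local update with step size `η` for the local risk `ℓ`, started from the global model `θ`:
`s` gradient steps for FedAvg, the minimizer of the proximal objective for FedProx. -/
def localUpdate (alg : FLAlgorithm) (η : ℝ) (ℓ : Coef d → ℝ) (θ : Coef d) : Coef d :=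
  match alg with
  | .fedAvg s => (fun ϑ => ϑ - η • gradient ℓ ϑ)^[s] θ
  | .fedProx => Classical.epsilon fun ϑ =>
      IsMinOn (fun ϑ' => ℓ ϑ' + 1 / (2 * η) * ‖ϑ' - θ‖ ^ 2) Set.univ ϑ

/-- The operator `f ↦ (1/m) ∑ j, f(x_j) k_{x_j}`, in coefficients
`θ ↦ (1/m) ∑ j, ⟨φ(x_j), θ⟩ φ(x_j)`. -/
def covOp (φ : 𝒳 → Coef d) (x : Fin m → 𝒳) : Coef d →L[ℝ] Coef d :=
  (1 / (m : ℝ)) • ∑ j, (innerSL ℝ (φ (x j))).smulRight (φ (x j))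

/-- A client's contribution to the round operator: `𝓛_i ^ s` with `𝓛_i = I - η covOp` for FedAvg,
and `(I + η covOp)⁻¹` for FedProx. -/
def localOp (alg : FLAlgorithm) (η : ℝ) (φ : 𝒳 → Coef d) (x : Fin m → 𝒳) :
    Coef d →L[ℝ] Coef d :=
  match alg with
  | .fedAvg s => (1 - η • covOp φ x) ^ s
  | .fedProx => Ring.inverse (1 + η • covOp φ x)

/-- The entries of `Ψ_i`: `(η/m) ∑_{τ<s} 𝓛_i^τ k_{x_j}` for FedAvg, and
`(η/m) (I + η covOp)⁻¹ k_{x_j}` for FedProx (`k_{x_j}` has coefficient `φ(x_j)`). -/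
def localPsi (alg : FLAlgorithm) (η : ℝ) (φ : 𝒳 → Coef d) (x : Fin m → 𝒳) (j : Fin m) : Coef d :=
  match alg with
  | .fedAvg s => (η / m) • ∑ τ ∈ Finset.range s, ((1 - η • covOp φ x) ^ τ) (φ (x j))
  | .fedProx => (η / m) • Ring.inverse (1 + η • covOp φ x) (φ (x j))

end Client

section System

variable {𝒳 : Type*} {d M : ℕ} {n : Fin M → ℕ}

/-- The total number `N` of data points. -/
def total (n : Fin M → ℕ) : ℕ := ∑ i, n i

/-- The aggregation weight `w_i = n_i / N`. -/
def weight (n : Fin M → ℕ) (i : Fin M) : ℝ := (n i : ℝ) / (total n : ℝ)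

/-- The coefficient `θ_t` of the global model after `t` rounds on the data `(x, y)`. -/
def globalModel (alg : FLAlgorithm) (η : ℝ) (φ : 𝒳 → Coef d) (x : ∀ i, Fin (n i) → 𝒳)
    (y : ∀ i, Fin (n i) → ℝ) (θ₀ : Coef d) : ℕ → Coef d
  | 0 => θ₀
  | t + 1 => ∑ i, weight n i •
      localUpdate alg η (localRisk φ (x i) (y i)) (globalModel alg η φ x y θ₀ t)

/-- The responses `y_{ij} = f_i^*(x_{ij}) + z_{ij}`, where `θs i` is the coefficient of `f_i^*`. -/
def response (φ : 𝒳 → Coef d) (x : ∀ i, Fin (n i) → 𝒳) (θs : Fin M → Coef d)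
    (z : ∀ i, Fin (n i) → ℝ) : ∀ i, Fin (n i) → ℝ :=
  fun i j => modelValue φ (θs i) (x i j) + z i j

/-- The operator `𝓛 = ∑ i, w_i 𝓛_i^s` (FedAvg) or `∑ i, w_i (I + η covOp_i)⁻¹` (FedProx). -/
def roundOp (alg : FLAlgorithm) (η : ℝ) (φ : 𝒳 → Coef d) (x : ∀ i, Fin (n i) → 𝒳) :
    Coef d →L[ℝ] Coef d :=
  ∑ i, weight n i • localOp alg η φ (x i)

/-- `z · Ψ` with `Ψ = (w_1 Ψ_1, …, w_M Ψ_M)`. -/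
def dotPsi (alg : FLAlgorithm) (η : ℝ) (φ : 𝒳 → Coef d) (x : ∀ i, Fin (n i) → 𝒳)
    (z : ∀ i, Fin (n i) → ℝ) : Coef d :=
  ∑ i, ∑ j, z i j • weight n i • localPsi alg η φ (x i) j

/-- The coefficient of `(I - 𝓛)⁻¹ ((f_1^*(x_1), …, f_M^*(x_M)) · Ψ)`; meaningful when `I - 𝓛` is
invertible. -/
def thetaBar (alg : FLAlgorithm) (η : ℝ) (φ : 𝒳 → Coef d) (x : ∀ i, Fin (n i) → 𝒳)
    (θs : Fin M → Coef d) : Coef d :=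
  Ring.inverse (1 - roundOp alg η φ x)
    (dotPsi alg η φ x fun i j => modelValue φ (θs i) (x i j))

/-- `γ = η max_i ‖K_{x_i}‖`, with the spectral norm. -/
def gam (η : ℝ) (φ : 𝒳 → Coef d) (x : ∀ i, Fin (n i) → 𝒳) : ℝ :=
  η * ⨆ i, ‖Matrix.toEuclideanCLM (𝕜 := ℝ) (gram φ (x i))‖

/-- `κ = γ s / (1 - (1 - γ)^s)` for FedAvg and `κ = 1 + γ` for FedProx. -/
def kap (alg : FLAlgorithm) (η : ℝ) (φ : 𝒳 → Coef d) (x : ∀ i, Fin (n i) → 𝒳) : ℝ :=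
  match alg with
  | .fedAvg s => gam η φ x * s / (1 - (1 - gam η φ x) ^ s)
  | .fedProx => 1 + gam η φ x

/-- The model heterogeneity `Γ = max_{i,j} ‖θ_i^* - θ_j^*‖`. -/
def heterogeneity (θs : Fin M → Coef d) : ℝ := ⨆ p : Fin M × Fin M, ‖θs p.1 - θs p.2‖

/-- `ν` is an admissible law of the noise vector: independent zero-mean coordinates with
variance at most `σ²`. -/
structure IsNoiseLaw (σ : ℝ) (ν : Measure (∀ i, Fin (n i) → ℝ)) : Prop where
  isProb : IsProbabilityMeasure ν
  indep : iIndepFun (fun (k : Σ i, Fin (n i)) (z : ∀ i, Fin (n i) → ℝ) => z k.1 k.2) ν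
  memLp : ∀ i j, MemLp (fun z : ∀ i, Fin (n i) → ℝ => z i j) 2 ν
  mean : ∀ i j, ∫ z, z i j ∂ν = 0
  var : ∀ i j, variance (fun z : ∀ i, Fin (n i) → ℝ => z i j) ν ≤ σ ^ 2

end System

section Probability

variable {Ω : Type*} [MeasurableSpace Ω] {d : ℕ}

/-- The random vector `V` (not necessarily centered) is sub-Gaussian with norm at most `K`:
`E exp(⟨u, V⟩² / K²) ≤ 2` for every unit vector `u`. -/
def SubGaussianVec (K : ℝ) (V : Ω → Coef d) (μ : Measure Ω) : Prop :=
  ∀ u : Coef d, ‖u‖ = 1 →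
    ∫⁻ ω, ENNReal.ofReal (Real.exp ((inner ℝ u (V ω)) ^ 2 / K ^ 2)) ∂μ ≤ 2

/-- The second-moment matrix `E[V Vᵀ]`. -/
def secondMoment (V : Ω → Coef d) (μ : Measure Ω) : Matrix (Fin d) (Fin d) ℝ :=
  Matrix.of fun a b => ∫ ω, V ω a * V ω b ∂μ

end Probability

end FedLearn

end

/-!
With `C_i` the covariance operator of client `i`, one local round satisfies
`I - 𝓛_i = q(η C_i) η C_i`, where the scalar filter `q` decreases from `s` at `0` to `s / κ` at `γ`.
As the spectrum of `η C_i` lies in `[0, γ]`, averaging over the clients gives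
`(s / κ) η C ≤ I - 𝓛 ≤ s η C` with `C = ∑ i, w_i C_i`, so a bound `C ≥ (α / 2) I` makes every round
a contraction towards `θ̄`, with rate `s η α / (2 κ)`.

* Noise: the covariance of the noise entering in one round is at most `σ² (s η / N) (I - 𝓛)`, and
  the extra factor `I - 𝓛` keeps the accumulated error of order `d` over the smallest eigenvalue
  of `I - 𝓛`, uniformly in `t`.
* Bias: `θ̄` is the mean of the `θ_i^*` with operator weights `w_i (I - 𝓛_i)`, so the energy of
  `θ̄ - θ` is at most the sum of the energies of the `θ_i^* - θ`. That sum is controlled by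
  `∑ i j, ⟨φ(x_ij), θ_i^* - θ⟩ ^ 2`, a sum of independent sub-exponential variables.
* Covariates: `C ≥ (α / 2) I` with high probability follows from Chernoff bounds at the points of
  an `ε`-net of the sphere, with `ε` depending only on `α` and `K`.
-/

namespace FedLearn

section Loewner

variable {E ι : Type*} [NormedAddCommGroup E] [InnerProductSpace ℝ E] [Fintype ι]

lemma inner_apply_mono {S T : E →L[ℝ] E} (h : S ≤ T) (v : E) :
    inner ℝ v (S v) ≤ inner ℝ v (T v) := by
  simpa [inner_sub_right] using ((ContinuousLinearMap.le_def S T).1 h).inner_nonneg_right v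

lemma le_of_inner_apply_le {S T : E →L[ℝ] E} (hS : (S : E →ₗ[ℝ] E).IsSymmetric)
    (hT : (T : E →ₗ[ℝ] E).IsSymmetric) (h : ∀ v, inner ℝ v (S v) ≤ inner ℝ v (T v)) : S ≤ T := by
  refine (ContinuousLinearMap.le_def S T).2
    ((ContinuousLinearMap.isPositive_iff _).2 ⟨hT.sub hS, fun v => ?_⟩)
  rw [real_inner_comm, sub_apply, inner_sub_right]
  exact sub_nonneg.2 (h v)

lemma sum_smul_le_sum_smul {w : ι → ℝ} (hw : ∀ i, 0 ≤ w i) {S T : ι → E →L[ℝ] E}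
    (h : ∀ i, S i ≤ T i) : ∑ i, w i • S i ≤ ∑ i, w i • T i := by
  rw [ContinuousLinearMap.le_def, ← Finset.sum_sub_distrib]
  refine ContinuousLinearMap.isPositive_sum _ fun i _ => ?_
  rw [← smul_sub]
  exact ((ContinuousLinearMap.le_def _ _).1 (h i)).smul_of_nonneg (hw i)

lemma isUnit_of_smul_one_le [CompleteSpace E] {T : E →L[ℝ] E} {r : ℝ} (hr : 0 < r)
    (h : r • 1 ≤ T) : IsUnit T := by
  refine T.isUnit_of_forall_le_norm_inner_map (c := ⟨r, hr.le⟩) hr fun v => ?_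
  have hv := inner_apply_mono h v
  simp only [smul_apply, one_apply_eq_self, inner_smul_right, real_inner_self_eq_norm_sq] at hv
  rw [real_inner_comm, mul_comm]
  exact hv.trans (le_abs_self _)

/-- `v` is the `A`-weighted mean of the `δ i`, and the difference of the two sides is its residual
`∑ i, ⟪v - δ i, A i (v - δ i)⟫`. -/
lemma inner_sum_apply_le_of_sum_apply_eq {A : ι → E →L[ℝ] E} (hA : ∀ i, 0 ≤ A i) {v : E}
    {δ : ι → E} (h : (∑ i, A i) v = ∑ i, A i (δ i)) :
    inner ℝ v ((∑ i, A i) v) ≤ ∑ i, inner ℝ (δ i) (A i (δ i)) := by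
  have hpos i := ((A i).nonneg_iff_isPositive).1 (hA i)
  have hsum : 0 ≤ ∑ i, inner ℝ (v - δ i) (A i (v - δ i)) :=
    Finset.sum_nonneg fun i _ => (hpos i).inner_nonneg_right _
  have hsymm i : inner ℝ (δ i) (A i v) = inner ℝ v (A i (δ i)) := by
    rw [← (hpos i).inner_left_eq_inner_right, real_inner_comm]
  have hcross : ∑ i, inner ℝ v (A i (δ i)) = inner ℝ v ((∑ i, A i) v) := by rw [h, inner_sum]
  have hself : ∑ i, inner ℝ v (A i v) = inner ℝ v ((∑ i, A i) v) := by
    rw [sum_apply, inner_sum]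
  simp only [map_sub, inner_sub_left, inner_sub_right, hsymm, Finset.sum_sub_distrib, hcross,
    hself] at hsum
  linarith

end Loewner

section Diagonal

variable {E ι : Type*} [NormedAddCommGroup E] [InnerProductSpace ℝ E] [Fintype ι]
  {b : OrthonormalBasis ι ℝ E} {S T : E →L[ℝ] E} {f g : ι → ℝ}

/-- `T` is diagonal in the orthonormal basis `b` with eigenvalues `f`; operators that are diagonal
in a common basis are compared and composed through their eigenvalues. -/
def IsDiagonal (b : OrthonormalBasis ι ℝ E) (T : E →L[ℝ] E) (f : ι → ℝ) : Prop :=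
  ∀ k, T (b k) = f k • b k

namespace IsDiagonal

lemma one : IsDiagonal b 1 (fun _ => 1) := fun k => by simp

lemma smul (c : ℝ) (hT : IsDiagonal b T f) : IsDiagonal b (c • T) (fun k => c * f k) := fun k => by
  rw [smul_apply, hT k, smul_smul]

lemma add (hS : IsDiagonal b S f) (hT : IsDiagonal b T g) :
    IsDiagonal b (S + T) (fun k => f k + g k) := fun k => by
  rw [add_apply, hS k, hT k, add_smul]

lemma sub (hS : IsDiagonal b S f) (hT : IsDiagonal b T g) :
    IsDiagonal b (S - T) (fun k => f k - g k) := fun k => by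
  rw [sub_apply, hS k, hT k, sub_smul]

lemma mul (hS : IsDiagonal b S f) (hT : IsDiagonal b T g) :
    IsDiagonal b (S * T) (fun k => f k * g k) := fun k => by
  rw [mul_apply_eq_comp, hT k, map_smul, hS k, smul_smul, mul_comm]

lemma pow (hT : IsDiagonal b T f) (t : ℕ) : IsDiagonal b (T ^ t) (fun k => f k ^ t) := by
  induction t with
  | zero => simpa only [pow_zero] using one
  | succ t ih => simpa only [pow_succ] using ih.mul hT

lemma geom_sum (hT : IsDiagonal b T f) (t : ℕ) :
    IsDiagonal b (∑ τ ∈ Finset.range t, T ^ τ) (fun k => ∑ τ ∈ Finset.range t, f k ^ τ) :=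
  fun k => by
    simp only [sum_apply, Finset.sum_smul]
    exact Finset.sum_congr rfl fun τ _ => hT.pow τ k

lemma ringInverse (hT : IsDiagonal b T f) (hu : IsUnit T) (hf : ∀ k, f k ≠ 0) :
    IsDiagonal b (Ring.inverse T) (fun k => (f k)⁻¹) := fun k => by
  rw [eq_inv_smul_iff₀ (hf k), ← map_smul, ← hT k]
  exact congrArg (· (b k)) (Ring.inverse_mul_cancel T hu)

lemma inner_basis_apply (hT : IsDiagonal b T f) (k : ι) (v : E) :
    inner ℝ (b k) (T v) = f k * inner ℝ (b k) v := by
  classical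
  conv_lhs => rw [← b.sum_repr' v, map_sum, inner_sum]
  simp [hT _, inner_smul_right, orthonormal_iff_ite.mp b.orthonormal, mul_comm]

lemma inner_apply (hT : IsDiagonal b T f) (u v : E) :
    inner ℝ u (T v) = ∑ k, f k * (inner ℝ (b k) u * inner ℝ (b k) v) := by
  rw [← b.sum_inner_mul_inner u (T v)]
  refine Finset.sum_congr rfl fun k _ => ?_
  rw [hT.inner_basis_apply, real_inner_comm u (b k)]
  ring

lemma inner_apply_self (hT : IsDiagonal b T f) (v : E) :
    inner ℝ v (T v) = ∑ k, f k * inner ℝ (b k) v ^ 2 := by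
  simp only [hT.inner_apply, sq]

lemma isSymmetric (hT : IsDiagonal b T f) : (T : E →ₗ[ℝ] E).IsSymmetric := fun u v => by
  change inner ℝ (T u) v = inner ℝ u (T v)
  rw [real_inner_comm, hT.inner_apply, hT.inner_apply]
  exact Finset.sum_congr rfl fun k _ => by ring

lemma inner_basis_apply_self (hT : IsDiagonal b T f) (k : ι) : inner ℝ (b k) (T (b k)) = f k := by
  simp [hT.inner_basis_apply]

lemma le_iff (hS : IsDiagonal b S f) (hT : IsDiagonal b T g) : S ≤ T ↔ ∀ k, f k ≤ g k := by
  refine ⟨fun h k => ?_, fun h => ?_⟩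
  · simpa only [hS.inner_basis_apply_self, hT.inner_basis_apply_self]
      using inner_apply_mono h (b k)
  · refine le_of_inner_apply_le hS.isSymmetric hT.isSymmetric fun v => ?_
    rw [hS.inner_apply_self, hT.inner_apply_self]
    exact Finset.sum_le_sum fun k _ => mul_le_mul_of_nonneg_right (h k) (sq_nonneg _)

lemma nonneg_iff (hT : IsDiagonal b T f) : 0 ≤ T ↔ ∀ k, 0 ≤ f k :=
  le_iff (fun k => by simp) hT

lemma norm_sq_apply (hT : IsDiagonal b T f) (v : E) :
    ‖T v‖ ^ 2 = ∑ k, f k ^ 2 * inner ℝ (b k) v ^ 2 := by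
  rw [← b.sum_sq_norm_inner_right (T v)]
  simp only [hT.inner_basis_apply, Real.norm_eq_abs, sq_abs, mul_pow]

end IsDiagonal

lemma exists_isDiagonal [FiniteDimensional ℝ E] (hT : (T : E →ₗ[ℝ] E).IsSymmetric) :
    ∃ (b : OrthonormalBasis (Fin (Module.finrank ℝ E)) ℝ E) (f : Fin (Module.finrank ℝ E) → ℝ),
      IsDiagonal b T f :=
  ⟨hT.eigenvectorBasis rfl, hT.eigenvalues rfl, hT.apply_eigenvectorBasis rfl⟩

end Diagonal

section Contraction

variable {E : Type*} [NormedAddCommGroup E] [InnerProductSpace ℝ E]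

lemma iterate_affine (T : E →L[ℝ] E) (c v : E) (t : ℕ) :
    (fun w => T w + c)^[t] v = (T ^ t) v + (∑ τ ∈ Finset.range t, T ^ τ) c := by
  induction t with
  | zero => simp
  | succ t ih =>
    rw [Function.iterate_succ_apply', ih, map_add, Finset.sum_range_succ', pow_succ']
    simp only [add_apply, sum_apply, pow_succ', map_sum, mul_apply_eq_comp, pow_zero,
      one_apply_eq_self, add_assoc]

variable [FiniteDimensional ℝ E] {T : E →L[ℝ] E} {r : ℝ}

lemma exists_isDiagonal_of_smul_one_le_one_sub (hT : 0 ≤ T) (hr : r • 1 ≤ 1 - T) :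
    ∃ (b : OrthonormalBasis (Fin (Module.finrank ℝ E)) ℝ E) (l : Fin (Module.finrank ℝ E) → ℝ),
      IsDiagonal b T l ∧ ∀ k, 0 ≤ l k ∧ l k ≤ 1 - r := by
  obtain ⟨b, l, hl⟩ := exists_isDiagonal ((T.nonneg_iff_isPositive).1 hT).isSymmetric
  refine ⟨b, l, hl, fun k => ⟨hl.nonneg_iff.1 hT k, ?_⟩⟩
  have := ((IsDiagonal.one.smul r).le_iff (IsDiagonal.one.sub hl)).1 hr k
  linarith

lemma norm_pow_apply_sq_le (hT : 0 ≤ T) (hr : r • 1 ≤ 1 - T) (t : ℕ) (v : E) :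
    ‖(T ^ t) v‖ ^ 2 ≤ (1 - r) ^ (2 * t) * ‖v‖ ^ 2 := by
  obtain ⟨b, l, hl, hbd⟩ := exists_isDiagonal_of_smul_one_le_one_sub hT hr
  rw [(hl.pow t).norm_sq_apply, ← b.sum_sq_norm_inner_right v, Finset.mul_sum]
  refine Finset.sum_le_sum fun k _ => ?_
  rw [← pow_mul', Real.norm_eq_abs, sq_abs]
  exact mul_le_mul_of_nonneg_right (pow_le_pow_left₀ (hbd k).1 (hbd k).2 _) (sq_nonneg _)

lemma geom_sum_sq_mul_one_sub_le {l r : ℝ} (hl : 0 ≤ l) (hr : 0 < r) (hlr : l ≤ 1 - r) (t : ℕ) :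
    (∑ τ ∈ Finset.range t, l ^ τ) ^ 2 * (1 - l) ≤ 1 / r := by
  have hl1 : 0 < 1 - l := by linarith
  have hsum : (∑ τ ∈ Finset.range t, l ^ τ) * (1 - l) ≤ 1 := by
    rw [geom_sum_mul_neg]
    linarith [pow_nonneg hl t]
  have hsum0 : 0 ≤ ∑ τ ∈ Finset.range t, l ^ τ := by positivity
  calc (∑ τ ∈ Finset.range t, l ^ τ) ^ 2 * (1 - l)
      = ((∑ τ ∈ Finset.range t, l ^ τ) * (1 - l)) ^ 2 / (1 - l) := by field_simp
    _ ≤ 1 / r := by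
        gcongr
        · exact pow_le_one₀ (mul_nonneg hsum0 hl1.le) hsum
        · linarith

lemma sum_norm_sq_geom_sum_apply_le {κ : Type*} [Fintype κ] (hT : 0 ≤ T) (hr0 : 0 < r)
    (hr : r • 1 ≤ 1 - T) {u : κ → E} {c : ℝ} (hc : 0 ≤ c)
    (hu : ∀ v, ∑ i, inner ℝ v (u i) ^ 2 ≤ c * inner ℝ v ((1 - T) v)) (t : ℕ) :
    ∑ i, ‖(∑ τ ∈ Finset.range t, T ^ τ) (u i)‖ ^ 2 ≤ c * Module.finrank ℝ E / r := by
  obtain ⟨b, l, hl, hbd⟩ := exists_isDiagonal_of_smul_one_le_one_sub hT hr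
  simp_rw [(hl.geom_sum t).norm_sq_apply]
  rw [Finset.sum_comm]
  calc ∑ k, ∑ i, (∑ τ ∈ Finset.range t, l k ^ τ) ^ 2 * inner ℝ (b k) (u i) ^ 2
      ≤ ∑ k, c * ((∑ τ ∈ Finset.range t, l k ^ τ) ^ 2 * (1 - l k)) :=
        Finset.sum_le_sum fun k _ => by
          have hk := hu (b k)
          rw [(IsDiagonal.one.sub hl).inner_basis_apply_self] at hk
          rw [← Finset.mul_sum, mul_left_comm]
          exact mul_le_mul_of_nonneg_left hk (sq_nonneg _)
    _ ≤ ∑ _k : Fin (Module.finrank ℝ E), c * (1 / r) := by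
        gcongr with k
        exact geom_sum_sq_mul_one_sub_le (hbd k).1 hr0 (hbd k).2 t
    _ = c * Module.finrank ℝ E / r := by
        rw [Finset.sum_const, Finset.card_univ, Fintype.card_fin, nsmul_eq_mul]
        ring

end Contraction

section Noise

variable {Ω ι E : Type*} [Fintype ι] [MeasurableSpace Ω] {ν : Measure Ω} [IsProbabilityMeasure ν]
  {Z : ι → Ω → ℝ}

lemma integral_const_add_sum_mul_sq (hind : iIndepFun Z ν) (hmem : ∀ k, MemLp (Z k) 2 ν)
    (hmean : ∀ k, ∫ ω, Z k ω ∂ν = 0) (c : ℝ) (a : ι → ℝ) :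
    ∫ ω, (c + ∑ k, Z k ω * a k) ^ 2 ∂ν = c ^ 2 + ∑ k, variance (Z k) ν * a k ^ 2 := by
  set Y : ι → Ω → ℝ := fun k ω => a k * Z k ω
  have hY k : MemLp (Y k) 2 ν := (hmem k).const_mul (a k)
  have hsum : MemLp (∑ k, Y k) 2 ν := memLp_finsetSum' _ fun k _ => hY k
  have hYmean : ∫ ω, (∑ k, Y k) ω ∂ν = 0 := by
    simp_rw [Finset.sum_apply]
    rw [integral_finsetSum _ fun k _ => (hY k).integrable one_le_two]
    simp [Y, integral_const_mul, hmean]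
  have hYvar : variance (∑ k, Y k) ν = ∑ k, variance (Z k) ν * a k ^ 2 := by
    rw [IndepFun.variance_sum (fun k _ => hY k) fun k _ l _ hkl =>
      (hind.indepFun hkl).comp (measurable_const_mul (a k)) (measurable_const_mul (a l))]
    exact Finset.sum_congr rfl fun k _ => by rw [variance_const_mul, mul_comm]
  have hmem_c : MemLp (fun ω => c + (∑ k, Y k) ω) 2 ν := (memLp_const c).add hsum
  have hsplit := variance_eq_sub hmem_c
  rw [variance_const_add hsum.aestronglyMeasurable, hYvar,
    integral_add (integrable_const c) (hsum.integrable one_le_two), hYmean] at hsplit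
  simp only [Pi.pow_apply, Finset.sum_apply, integral_const, probReal_univ, smul_eq_mul, one_mul,
    add_zero] at hsplit
  simp_rw [mul_comm (Z _ _)]
  linarith

variable [NormedAddCommGroup E] [InnerProductSpace ℝ E]

lemma integrable_norm_add_sum_smul_sq (hmem : ∀ k, MemLp (Z k) 2 ν) (m : E) (a : ι → E) :
    Integrable (fun ω => ‖m + ∑ k, Z k ω • a k‖ ^ 2) ν :=
  have hsum : MemLp (fun ω => ∑ k, Z k ω • a k) 2 ν := memLp_finsetSum _ fun k _ =>
    (ContinuousLinearMap.toSpanSingleton ℝ (a k)).comp_memLp' (hmem k)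
  ((memLp_const m).add hsum).integrable_norm_pow two_ne_zero

lemma integral_norm_add_sum_smul_sq [FiniteDimensional ℝ E] (hind : iIndepFun Z ν)
    (hmem : ∀ k, MemLp (Z k) 2 ν) (hmean : ∀ k, ∫ ω, Z k ω ∂ν = 0) (m : E) (a : ι → E) :
    ∫ ω, ‖m + ∑ k, Z k ω • a k‖ ^ 2 ∂ν = ‖m‖ ^ 2 + ∑ k, variance (Z k) ν * ‖a k‖ ^ 2 := by
  set b := stdOrthonormalBasis ℝ E
  have hcoord i ω : inner ℝ (b i) (m + ∑ k, Z k ω • a k)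
      = inner ℝ (b i) m + ∑ k, Z k ω * inner ℝ (b i) (a k) := by
    simp only [inner_add_right, inner_sum, inner_smul_right]
  have hint i : Integrable
      (fun ω => (inner ℝ (b i) m + ∑ k, Z k ω * inner ℝ (b i) (a k)) ^ 2) ν := by
    have hsum : MemLp (fun ω => ∑ k, Z k ω * inner ℝ (b i) (a k)) 2 ν :=
      memLp_finsetSum _ fun k _ => (hmem k).mul_const _
    exact ((memLp_const (inner ℝ (b i) m)).add hsum).integrable_sq
  simp_rw [← b.sum_sq_norm_inner_right, Real.norm_eq_abs, sq_abs, hcoord]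
  rw [integral_finsetSum _ fun i _ => hint i]
  simp_rw [integral_const_add_sum_mul_sq hind hmem hmean, Finset.sum_add_distrib, Finset.mul_sum]
  rw [Finset.sum_comm]

end Noise

namespace FLAlgorithm

/-- The spectral filter `q` of one local round: with `a = η • covOp φ x`, the response weights
`localPsi` are `(η / m) q(a) φ(x_j)` and `localOp` is `1 - q(a) a`. It is defined over a ring so as
to apply both to operators and to their eigenvalues. -/
noncomputable def filter {A : Type*} [Ring A] (alg : FLAlgorithm) (a : A) : A :=
  match alg with
  | .fedAvg s => ∑ τ ∈ Finset.range s, (1 - a) ^ τ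
  | .fedProx => Ring.inverse (1 + a)

/-- The step-size condition `γ < 1`, which is only imposed on FedAvg. -/
def StepAdmissible (alg : FLAlgorithm) (γ : ℝ) : Prop := (∃ s, alg = .fedAvg s) → γ < 1

variable {alg : FLAlgorithm} {a γ : ℝ}

lemma filter_fedProx (a : ℝ) : fedProx.filter a = (1 + a)⁻¹ := Ring.inverse_eq_inv _

lemma filter_zero (alg : FLAlgorithm) : alg.filter (0 : ℝ) = alg.steps := by
  cases alg <;> simp [filter, steps]

lemma filter_antitone (ha : 0 ≤ a) (haγ : a ≤ γ) (hγ : alg.StepAdmissible γ) :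
    alg.filter γ ≤ alg.filter a := by
  cases alg with
  | fedAvg s =>
    have hγ1 : γ < 1 := hγ ⟨s, rfl⟩
    exact Finset.sum_le_sum fun τ _ => pow_le_pow_left₀ (by linarith) (by linarith) τ
  | fedProx =>
    simp only [filter_fedProx]
    exact inv_anti₀ (by linarith) (by linarith)

lemma StepAdmissible.mono (hγ : alg.StepAdmissible γ) (haγ : a ≤ γ) : alg.StepAdmissible a :=
  fun h => haγ.trans_lt (hγ h)

lemma filter_le_steps (ha : 0 ≤ a) (hadm : alg.StepAdmissible a) : alg.filter a ≤ alg.steps :=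
  alg.filter_zero ▸ filter_antitone le_rfl ha hadm

lemma filter_nonneg (ha : 0 ≤ a) (hadm : alg.StepAdmissible a) : 0 ≤ alg.filter a := by
  cases alg with
  | fedAvg s =>
    have ha1 : a < 1 := hadm ⟨s, rfl⟩
    exact Finset.sum_nonneg fun τ _ => pow_nonneg (by linarith) τ
  | fedProx =>
    rw [filter_fedProx]
    positivity

lemma filter_pos (hs : 1 ≤ alg.steps) (ha : 0 ≤ a) (hadm : alg.StepAdmissible a) :
    0 < alg.filter a := by
  cases alg with
  | fedAvg s =>
    have ha1 : a < 1 := hadm ⟨s, rfl⟩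
    exact Finset.sum_pos (fun τ _ => pow_pos (by linarith) τ)
      (Finset.nonempty_range_iff.2 (Nat.one_le_iff_ne_zero.1 hs))
  | fedProx =>
    rw [filter_fedProx]
    positivity

lemma one_sub_filter_mul_fedAvg {A : Type*} [Ring A] (s : ℕ) (a : A) :
    1 - (fedAvg s).filter a * a = (1 - a) ^ s := by
  have h := geom_sum_mul_neg (1 - a) s
  rw [sub_sub_cancel] at h
  rw [filter, h, sub_sub_cancel]

lemma one_sub_filter_mul_fedProx {A : Type*} [Ring A] {a : A} (ha : IsUnit (1 + a)) :
    1 - fedProx.filter a * a = Ring.inverse (1 + a) := by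
  have h := Ring.inverse_mul_cancel _ ha
  rw [mul_add, mul_one] at h
  rw [filter, sub_eq_iff_eq_add, h]

lemma filter_mul_le_one (ha : 0 ≤ a) (hadm : alg.StepAdmissible a) : alg.filter a * a ≤ 1 := by
  rw [← sub_nonneg]
  cases alg with
  | fedAvg s =>
    have ha1 : a < 1 := hadm ⟨s, rfl⟩
    rw [one_sub_filter_mul_fedAvg]
    exact pow_nonneg (by linarith) s
  | fedProx =>
    have hpos : 0 < 1 + a := by positivity
    rw [one_sub_filter_mul_fedProx hpos.ne'.isUnit, Ring.inverse_eq_inv]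
    exact inv_nonneg.2 hpos.le

end FLAlgorithm

section Filter

variable {E ι : Type*} [NormedAddCommGroup E] [InnerProductSpace ℝ E] [CompleteSpace E] [Fintype ι]
  {b : OrthonormalBasis ι ℝ E} {T : E →L[ℝ] E} {f : ι → ℝ}

lemma isUnit_one_add (hT : 0 ≤ T) : IsUnit (1 + T) := by
  refine isUnit_of_smul_one_le one_pos ?_
  rw [one_smul, ContinuousLinearMap.le_def, add_sub_cancel_left]
  exact (T.nonneg_iff_isPositive).1 hT

lemma IsDiagonal.filter (hT : IsDiagonal b T f) (hf : ∀ k, 0 ≤ f k) (alg : FLAlgorithm) :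
    IsDiagonal b (alg.filter T) (fun k => alg.filter (f k)) := by
  cases alg with
  | fedAvg s => exact (one.sub hT).geom_sum s
  | fedProx =>
    simp only [FLAlgorithm.filter_fedProx]
    exact (one.add hT).ringInverse (isUnit_one_add (hT.nonneg_iff.2 hf)) fun k => by
      have := hf k
      positivity

end Filter

section Client

variable {𝒳 : Type*} {d m : ℕ}

lemma covOp_apply (φ : 𝒳 → Coef d) (x : Fin m → 𝒳) (v : Coef d) :
    covOp φ x v = (1 / (m : ℝ)) • ∑ j, inner ℝ (φ (x j)) v • φ (x j) := by
  simp [covOp]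

lemma inner_covOp (φ : 𝒳 → Coef d) (x : Fin m → 𝒳) (u v : Coef d) :
    inner ℝ u (covOp φ x v) = 1 / (m : ℝ) * ∑ j, inner ℝ (φ (x j)) u * inner ℝ (φ (x j)) v := by
  simp only [covOp_apply, inner_smul_right, inner_sum, real_inner_comm, mul_comm]

lemma inner_covOp_self (φ : 𝒳 → Coef d) (x : Fin m → 𝒳) (v : Coef d) :
    inner ℝ v (covOp φ x v) = 1 / (m : ℝ) * ∑ j, inner ℝ (φ (x j)) v ^ 2 := by
  simp only [inner_covOp, sq]

lemma covOp_nonneg (φ : 𝒳 → Coef d) (x : Fin m → 𝒳) : 0 ≤ covOp φ x := by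
  refine (ContinuousLinearMap.nonneg_iff_isPositive _).2
    ((ContinuousLinearMap.isPositive_iff _).2 ⟨fun u v => ?_, fun v => ?_⟩)
  · change inner ℝ (covOp φ x u) v = inner ℝ u (covOp φ x v)
    simp only [real_inner_comm v, inner_covOp, mul_comm]
  · rw [real_inner_comm, inner_covOp_self]
    positivity

lemma norm_covOp_sq_le (φ : 𝒳 → Coef d) (x : Fin m → 𝒳) (v : Coef d) :
    ‖covOp φ x v‖ ^ 2
      ≤ ‖Matrix.toEuclideanCLM (𝕜 := ℝ) (gram φ x)‖ * inner ℝ v (covOp φ x v) := by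
  set g : EuclideanSpace ℝ (Fin m) := WithLp.toLp 2 fun j => inner ℝ (φ (x j)) v with hg
  set G := Matrix.toEuclideanCLM (𝕜 := ℝ) (gram φ x) with hG
  have hnorm : ‖g‖ ^ 2 = ∑ j, inner ℝ (φ (x j)) v ^ 2 := by
    simp [EuclideanSpace.norm_sq_eq, hg]
  have hGg j : (G g) j = inner ℝ (φ (x j)) (covOp φ x v) := by
    rw [covOp_apply, inner_smul_right, inner_sum, Finset.mul_sum, hG]
    simp only [Matrix.ofLp_toEuclideanCLM, Matrix.mulVec, dotProduct, gram, Matrix.of_apply,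
      kern, hg]
    refine Finset.sum_congr rfl fun l _ => ?_
    rw [inner_smul_right]
    ring
  have hform : ‖covOp φ x v‖ ^ 2 = 1 / (m : ℝ) * inner ℝ g (G g) := by
    rw [← real_inner_self_eq_norm_sq, inner_covOp, PiLp.inner_apply]
    refine congrArg _ (Finset.sum_congr rfl fun j _ => ?_)
    rw [hGg]
    rfl
  calc ‖covOp φ x v‖ ^ 2 = 1 / (m : ℝ) * inner ℝ g (G g) := hform
    _ ≤ 1 / (m : ℝ) * (‖g‖ * (‖G‖ * ‖g‖)) := by
        gcongr
        exact (real_inner_le_norm _ _).trans (by gcongr; exact G.le_opNorm g)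
    _ = ‖G‖ * inner ℝ v (covOp φ x v) := by
        rw [inner_covOp_self, ← hnorm]
        ring

lemma exists_isDiagonal_smul_covOp {η γ : ℝ} (hη : 0 ≤ η) (φ : 𝒳 → Coef d) (x : Fin m → 𝒳)
    (hγ : η * ‖Matrix.toEuclideanCLM (𝕜 := ℝ) (gram φ x)‖ ≤ γ) :
    ∃ (b : OrthonormalBasis (Fin (Module.finrank ℝ (Coef d))) ℝ (Coef d))
      (a : Fin (Module.finrank ℝ (Coef d)) → ℝ),
      IsDiagonal b (η • covOp φ x) a ∧ ∀ k, 0 ≤ a k ∧ a k ≤ γ := by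
  have hpos := ((covOp φ x).nonneg_iff_isPositive).1 (covOp_nonneg φ x)
  obtain ⟨b, l, hl⟩ := exists_isDiagonal hpos.isSymmetric
  refine ⟨b, _, hl.smul η, fun k => ?_⟩
  have hl0 : 0 ≤ l k := hl.nonneg_iff.1 (covOp_nonneg φ x) k
  refine ⟨mul_nonneg hη hl0, le_trans (mul_le_mul_of_nonneg_left ?_ hη) hγ⟩
  have hsq := norm_covOp_sq_le φ x (b k)
  rw [hl.inner_basis_apply_self, hl k, norm_smul, b.norm_eq_one, mul_one, Real.norm_eq_abs, sq_abs,
    sq] at hsq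
  rcases hl0.eq_or_lt with hzero | hlpos
  · exact hzero ▸ norm_nonneg _
  · exact le_of_mul_le_mul_right hsq hlpos

variable {alg : FLAlgorithm} {η γ : ℝ} {φ : 𝒳 → Coef d} {x : Fin m → 𝒳}

lemma localPsi_eq_filter (alg : FLAlgorithm) (η : ℝ) (φ : 𝒳 → Coef d) (x : Fin m → 𝒳) (j : Fin m) :
    localPsi alg η φ x j = (η / m) • alg.filter (η • covOp φ x) (φ (x j)) := by
  cases alg <;> simp [localPsi, FLAlgorithm.filter]

lemma isUnit_one_add_smul_covOp (hη : 0 ≤ η) : IsUnit (1 + η • covOp φ x) := by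
  have hpos := ((covOp φ x).nonneg_iff_isPositive).1 (covOp_nonneg φ x)
  exact isUnit_one_add ((ContinuousLinearMap.nonneg_iff_isPositive _).2 (hpos.smul_of_nonneg hη))

lemma localOp_eq_one_sub_filter_mul (hη : 0 ≤ η) :
    localOp alg η φ x = 1 - alg.filter (η • covOp φ x) * η • covOp φ x := by
  cases alg with
  | fedAvg s => rw [FLAlgorithm.one_sub_filter_mul_fedAvg, localOp]
  | fedProx =>
    rw [FLAlgorithm.one_sub_filter_mul_fedProx (isUnit_one_add_smul_covOp hη), localOp]

lemma IsDiagonal.one_sub_localOp {ι : Type*} [Fintype ι] {b : OrthonormalBasis ι ℝ (Coef d)}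
    {a : ι → ℝ} (hη : 0 ≤ η) (ha : IsDiagonal b (η • covOp φ x) a) (ha0 : ∀ k, 0 ≤ a k) :
    IsDiagonal b (1 - localOp alg η φ x) (fun k => alg.filter (a k) * a k) := by
  rw [localOp_eq_one_sub_filter_mul hη, sub_sub_cancel]
  exact (ha.filter ha0 alg).mul ha

variable (hη : 0 ≤ η) (hγ : η * ‖Matrix.toEuclideanCLM (𝕜 := ℝ) (gram φ x)‖ ≤ γ)
  (hadm : alg.StepAdmissible γ)

include hη hγ

lemma smul_covOp_le_smul_one : η • covOp φ x ≤ γ • 1 := by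
  obtain ⟨b, a, ha, hbd⟩ := exists_isDiagonal_smul_covOp hη φ x hγ
  exact (ha.le_iff (IsDiagonal.one.smul γ)).2 fun k => (hbd k).2.trans_eq (mul_one γ).symm

include hadm

lemma localOp_nonneg : 0 ≤ localOp alg η φ x := by
  obtain ⟨b, a, ha, hbd⟩ := exists_isDiagonal_smul_covOp hη φ x hγ
  have hL := IsDiagonal.one.sub (ha.one_sub_localOp (alg := alg) hη fun k => (hbd k).1)
  rw [sub_sub_cancel] at hL
  exact hL.nonneg_iff.2 fun k => sub_nonneg.2
    (FLAlgorithm.filter_mul_le_one (hbd k).1 (hadm.mono (hbd k).2))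

lemma one_sub_localOp_nonneg : 0 ≤ 1 - localOp alg η φ x := by
  obtain ⟨b, a, ha, hbd⟩ := exists_isDiagonal_smul_covOp hη φ x hγ
  exact (ha.one_sub_localOp hη fun k => (hbd k).1).nonneg_iff.2 fun k =>
    mul_nonneg (FLAlgorithm.filter_nonneg (hbd k).1 (hadm.mono (hbd k).2)) (hbd k).1

lemma filter_smul_covOp_le_one_sub_localOp :
    alg.filter γ • η • covOp φ x ≤ 1 - localOp alg η φ x := by
  obtain ⟨b, a, ha, hbd⟩ := exists_isDiagonal_smul_covOp hη φ x hγ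
  refine ((ha.smul _).le_iff (ha.one_sub_localOp hη fun k => (hbd k).1)).2 fun k => ?_
  exact mul_le_mul_of_nonneg_right
    (FLAlgorithm.filter_antitone (hbd k).1 (hbd k).2 hadm) (hbd k).1

lemma one_sub_localOp_le_steps_smul_covOp :
    1 - localOp alg η φ x ≤ (alg.steps : ℝ) • η • covOp φ x := by
  obtain ⟨b, a, ha, hbd⟩ := exists_isDiagonal_smul_covOp hη φ x hγ
  refine ((ha.one_sub_localOp hη fun k => (hbd k).1).le_iff (ha.smul _)).2 fun k => ?_
  exact mul_le_mul_of_nonneg_right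
    (FLAlgorithm.filter_le_steps (hbd k).1 (hadm.mono (hbd k).2)) (hbd k).1

lemma sum_inner_localPsi_sq_le (v : Coef d) :
    ∑ j, inner ℝ v (localPsi alg η φ x j) ^ 2
      ≤ η * alg.steps / m * inner ℝ v ((1 - localOp alg η φ x) v) := by
  obtain ⟨b, a, ha, hbd⟩ := exists_isDiagonal_smul_covOp hη φ x hγ
  have hQ := ha.filter (fun k => (hbd k).1) alg
  set Q := alg.filter (η • covOp φ x)
  have hpsi j : inner ℝ v (localPsi alg η φ x j) = η / m * inner ℝ (φ (x j)) (Q v) := by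
    rw [localPsi_eq_filter, inner_smul_right, real_inner_comm (Q v)]
    exact congrArg _ (hQ.isSymmetric v (φ (x j))).symm
  have hsum : ∑ j, inner ℝ v (localPsi alg η φ x j) ^ 2
      = η / m * inner ℝ (Q v) ((η • covOp φ x) (Q v)) := by
    rw [smul_apply, inner_smul_right, inner_covOp_self]
    simp only [hpsi, mul_pow, ← Finset.mul_sum]
    ring
  rw [hsum, ha.inner_apply_self,
    (ha.one_sub_localOp hη fun k => (hbd k).1).inner_apply_self, mul_div_right_comm, mul_assoc]
  refine mul_le_mul_of_nonneg_left ?_ (by positivity)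
  rw [Finset.mul_sum]
  refine Finset.sum_le_sum fun k _ => ?_
  rw [hQ.inner_basis_apply]
  calc a k * (alg.filter (a k) * inner ℝ (b k) v) ^ 2
      = alg.filter (a k) * (alg.filter (a k) * a k * inner ℝ (b k) v ^ 2) := by ring
    _ ≤ alg.steps * (alg.filter (a k) * a k * inner ℝ (b k) v ^ 2) := by
        have hadm_k := hadm.mono (hbd k).2
        refine mul_le_mul_of_nonneg_right (FLAlgorithm.filter_le_steps (hbd k).1 hadm_k) ?_
        exact mul_nonneg (mul_nonneg (FLAlgorithm.filter_nonneg (hbd k).1 hadm_k) (hbd k).1)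
          (sq_nonneg _)

end Client

section LocalUpdate

lemma hasGradientAt_of_quadratic {E : Type*} [NormedAddCommGroup E] [InnerProductSpace ℝ E]
    [CompleteSpace E] {F : E → ℝ} {a g : E} (T : E →L[ℝ] E)
    (h : ∀ u, F (a + u) = F a + inner ℝ u g + inner ℝ u (T u)) : HasGradientAt F g a := by
  rw [hasGradientAt_iff_isLittleO_nhds_zero]
  have hrem u : F (a + u) - F a - inner ℝ g u = inner ℝ u (T u) := by
    rw [h, real_inner_comm u g]
    ring
  simp_rw [hrem]
  refine Asymptotics.IsBigO.trans_isLittleO (g := fun u : E => ‖u‖ ^ 2) ?_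
    (Asymptotics.isLittleO_norm_pow_id one_lt_two)
  refine Asymptotics.IsBigO.of_bound ‖T‖ (Filter.Eventually.of_forall fun u => ?_)
  calc ‖(inner ℝ u (T u) : ℝ)‖ ≤ ‖u‖ * ‖T u‖ := norm_inner_le_norm _ _
    _ ≤ ‖u‖ * (‖T‖ * ‖u‖) := by gcongr; exact T.le_opNorm u
    _ = ‖T‖ * ‖‖u‖ ^ 2‖ := by rw [norm_pow, norm_norm]; ring

lemma epsilon_isMinOn_univ_eq {X : Type*} [Nonempty X] {F : X → ℝ} {b : X}
    (h : ∀ a ≠ b, F b < F a) : Classical.epsilon (fun a => IsMinOn F Set.univ a) = b := by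
  have hb : IsMinOn F Set.univ b := fun a _ => by
    change F b ≤ F a
    rcases eq_or_ne a b with rfl | hab
    exacts [le_rfl, (h a hab).le]
  by_contra hne
  exact (h _ hne).not_ge (Classical.epsilon_spec ⟨b, hb⟩ (Set.mem_univ b))

variable {𝒳 : Type*} {d m : ℕ} {η : ℝ} (φ : 𝒳 → Coef d) (x : Fin m → 𝒳) (y : Fin m → ℝ)

/-- The empirical cross moment `(1/m) ∑ j, y_j φ(x_j)` of features and responses, the constant part
of `-∇ localRisk`. -/
noncomputable def crossMoment (φ : 𝒳 → Coef d) (x : Fin m → 𝒳) (y : Fin m → ℝ) : Coef d :=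
  (1 / (m : ℝ)) • ∑ j, y j • φ (x j)

lemma localRisk_add (θ u : Coef d) :
    localRisk φ x y (θ + u) = localRisk φ x y θ + inner ℝ u (covOp φ x θ - crossMoment φ x y)
      + inner ℝ u (((1 / 2 : ℝ) • covOp φ x) u) := by
  simp only [localRisk, crossMoment, smul_apply, inner_sub_right, inner_smul_right, inner_covOp,
    inner_sum, Finset.mul_sum, ← Finset.sum_sub_distrib, ← Finset.sum_add_distrib, modelValue,
    inner_add_right]
  refine Finset.sum_congr rfl fun j _ => ?_
  rw [real_inner_comm (φ (x j)) u]
  ring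

lemma gradient_localRisk (θ : Coef d) :
    gradient (localRisk φ x y) θ = covOp φ x θ - crossMoment φ x y :=
  (hasGradientAt_of_quadratic _ (localRisk_add φ x y θ)).gradient

lemma sum_smul_localPsi (alg : FLAlgorithm) (η : ℝ) :
    ∑ j, y j • localPsi alg η φ x j = alg.filter (η • covOp φ x) (η • crossMoment φ x y) := by
  rw [crossMoment, smul_smul, map_smul, map_sum, Finset.smul_sum]
  refine Finset.sum_congr rfl fun j _ => ?_
  rw [localPsi_eq_filter, map_smul, smul_comm, mul_one_div]

lemma sum_modelValue_smul_localPsi {alg : FLAlgorithm} (hη : 0 ≤ η) (θ : Coef d) :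
    ∑ j, modelValue φ θ (x j) • localPsi alg η φ x j = (1 - localOp alg η φ x) θ := by
  have hcross : crossMoment φ x (fun j => modelValue φ θ (x j)) = covOp φ x θ :=
    (covOp_apply φ x θ).symm
  rw [sum_smul_localPsi, hcross, localOp_eq_one_sub_filter_mul hη, sub_sub_cancel]
  rfl

lemma localRisk_add_prox_lt (hη : 0 < η) {θ b : Coef d}
    (hb : (1 + η • covOp φ x) b = θ + η • crossMoment φ x y) {a : Coef d} (hab : a ≠ b) :
    localRisk φ x y b + 1 / (2 * η) * ‖b - θ‖ ^ 2
      < localRisk φ x y a + 1 / (2 * η) * ‖a - θ‖ ^ 2 := by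
  obtain ⟨u, rfl⟩ : ∃ u, a = b + u := ⟨a - b, (add_sub_cancel b a).symm⟩
  have hgrad : covOp φ x b - crossMoment φ x y = -((1 / η) • (b - θ)) := by
    rw [← smul_neg, neg_sub, one_div, eq_inv_smul_iff₀ hη.ne', smul_sub,
      sub_eq_sub_iff_add_eq_add, ← hb]
    simp [add_comm]
  have hcov := inner_apply_mono (covOp_nonneg φ x) u
  rw [zero_apply, inner_zero_right] at hcov
  have hupos : 0 < 1 / (2 * η) * ‖u‖ ^ 2 := by
    have : 0 < ‖u‖ := norm_pos_iff.2 (by simpa using hab)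
    positivity
  rw [localRisk_add, hgrad, add_sub_right_comm, norm_add_sq_real, inner_neg_right, inner_smul_right,
    real_inner_comm u, smul_apply, inner_smul_right]
  have hcancel : 1 / (2 * η) * (2 * inner ℝ u (b - θ)) = 1 / η * inner ℝ u (b - θ) := by
    field_simp
  linarith

lemma localUpdate_eq {alg : FLAlgorithm} (hη : 0 < η) (θ : Coef d) :
    localUpdate alg η (localRisk φ x y) θ
      = localOp alg η φ x θ + ∑ j, y j • localPsi alg η φ x j := by
  rw [sum_smul_localPsi]
  cases alg with
  | fedAvg s =>
    have hstep : (fun ϑ => ϑ - η • gradient (localRisk φ x y) ϑ)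
        = fun ϑ => (1 - η • covOp φ x) ϑ + η • crossMoment φ x y := by
      funext ϑ
      rw [gradient_localRisk, smul_sub, sub_apply, one_apply_eq_self, smul_apply]
      abel
    rw [localUpdate, hstep, iterate_affine, localOp, FLAlgorithm.filter]
  | fedProx =>
    refine epsilon_isMinOn_univ_eq fun a hab => localRisk_add_prox_lt φ x y hη ?_ hab
    rw [localOp, FLAlgorithm.filter, ← map_add]
    exact congrArg (· (θ + η • crossMoment φ x y))
      (Ring.mul_inverse_cancel _ (isUnit_one_add_smul_covOp hη.le))

end LocalUpdate

section Round

variable {𝒳 : Type*} {d M : ℕ} {n : Fin M → ℕ} {alg : FLAlgorithm} {η a : ℝ} {φ : 𝒳 → Coef d}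
  {x : ∀ i, Fin (n i) → 𝒳}

lemma weight_nonneg (n : Fin M → ℕ) (i : Fin M) : 0 ≤ weight n i := by
  rw [weight]
  positivity

lemma sum_weight (hN : total n ≠ 0) : ∑ i, weight n i = 1 := by
  simp only [weight]
  rw [← Finset.sum_div, div_eq_one_iff_eq (Nat.cast_ne_zero.2 hN), total, Nat.cast_sum]

lemma weight_mul_one_div_mul_sum (n : Fin M → ℕ) (i : Fin M) (f : Fin (n i) → ℝ) :
    weight n i * (1 / (n i : ℝ) * ∑ j, f j) = 1 / (total n : ℝ) * ∑ j, f j := by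
  rcases eq_or_ne (n i) 0 with hi | hi
  · have : IsEmpty (Fin (n i)) := by
      rw [hi]
      infer_instance
    simp
  · rw [weight]
    field_simp

lemma weight_mul_div (n : Fin M → ℕ) (i : Fin M) (c : ℝ) :
    weight n i ^ 2 * (c / n i) = c / total n * weight n i := by
  rcases eq_or_ne (n i) 0 with hi | hi
  · simp [weight, hi]
  · rw [weight]
    field_simp

/-- The covariance operator `∑ i, w_i covOp_i` of the pooled data of all clients. -/
noncomputable def pooledCovOp (φ : 𝒳 → Coef d) (x : ∀ i, Fin (n i) → 𝒳) : Coef d →L[ℝ] Coef d :=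
  ∑ i, weight n i • covOp φ (x i)

lemma sum_weight_mul_inner_covOp (φ : 𝒳 → Coef d) (x : ∀ i, Fin (n i) → 𝒳) (v : Fin M → Coef d) :
    ∑ i, weight n i * inner ℝ (v i) (covOp φ (x i) (v i))
      = 1 / (total n : ℝ) * ∑ i, ∑ j, inner ℝ (φ (x i j)) (v i) ^ 2 := by
  rw [Finset.mul_sum]
  simp only [inner_covOp_self, weight_mul_one_div_mul_sum]

lemma smul_one_le_pooledCovOp (hN : total n ≠ 0)
    (h : ∀ v, total n * a * ‖v‖ ^ 2 ≤ ∑ i, ∑ j, inner ℝ (φ (x i j)) v ^ 2) :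
    a • 1 ≤ pooledCovOp φ x := by
  have hpos : 0 ≤ pooledCovOp φ x := by
    simpa [pooledCovOp] using sum_smul_le_sum_smul (weight_nonneg n) fun i => covOp_nonneg φ (x i)
  refine le_of_inner_apply_le (fun u v => ?_)
    ((pooledCovOp φ x).nonneg_iff_isPositive.1 hpos).isSymmetric fun v => ?_
  · simp [real_inner_smul_left, real_inner_smul_right]
  · have hpooled : inner ℝ v (pooledCovOp φ x v)
        = 1 / (total n : ℝ) * ∑ i, ∑ j, inner ℝ (φ (x i j)) v ^ 2 := by
      rw [← sum_weight_mul_inner_covOp φ x fun _ => v]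
      simp [pooledCovOp, sum_apply, inner_sum, inner_smul_right]
    rw [hpooled, one_div_mul_eq_div, le_div_iff₀ (by positivity)]
    refine le_of_eq_of_le ?_ (h v)
    simp [inner_smul_right]
    ring

lemma mul_norm_gram_le_gam (hη : 0 ≤ η) (φ : 𝒳 → Coef d) (x : ∀ i, Fin (n i) → 𝒳) (i : Fin M) :
    η * ‖Matrix.toEuclideanCLM (𝕜 := ℝ) (gram φ (x i))‖ ≤ gam η φ x :=
  mul_le_mul_of_nonneg_left
    (le_ciSup (f := fun i => ‖Matrix.toEuclideanCLM (𝕜 := ℝ) (gram φ (x i))‖)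
      (Set.finite_range _).bddAbove i) hη

lemma gam_nonneg (hη : 0 ≤ η) (φ : 𝒳 → Coef d) (x : ∀ i, Fin (n i) → 𝒳) : 0 ≤ gam η φ x :=
  mul_nonneg hη (Real.iSup_nonneg fun _ => norm_nonneg _)

lemma mul_le_gam (hη : 0 ≤ η) (hN : total n ≠ 0) (hd : 0 < d) (hC : a • 1 ≤ pooledCovOp φ x) :
    η * a ≤ gam η φ x := by
  have : NeZero d := ⟨hd.ne'⟩
  have hle : η • pooledCovOp φ x ≤ gam η φ x • 1 := by
    have hsum := sum_smul_le_sum_smul (weight_nonneg n) fun i =>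
      smul_covOp_le_smul_one hη (mul_norm_gram_le_gam hη φ x i)
    rw [← Finset.sum_smul, sum_weight hN, one_smul] at hsum
    rwa [pooledCovOp, Finset.smul_sum, Finset.sum_congr rfl fun i _ => smul_comm _ _ _]
  set e : Coef d := EuclideanSpace.single 0 1 with he
  have he1 : ‖e‖ = 1 := by simp [he]
  have hlow := inner_apply_mono hC e
  have hupp := inner_apply_mono hle e
  simp only [smul_apply, one_apply_eq_self, inner_smul_right, real_inner_self_eq_norm_sq, he1,
    one_pow, mul_one] at hlow hupp
  exact (mul_le_mul_of_nonneg_left hlow hη).trans hupp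

lemma gam_pos (hη : 0 < η) (hN : total n ≠ 0) (hd : 0 < d) (ha : 0 < a)
    (hC : a • 1 ≤ pooledCovOp φ x) : 0 < gam η φ x :=
  (mul_pos hη ha).trans_le (mul_le_gam hη.le hN hd hC)

lemma kap_eq_steps_div_filter (alg : FLAlgorithm) (hγ : gam η φ x ≠ 0) :
    kap alg η φ x = alg.steps / alg.filter (gam η φ x) := by
  cases alg with
  | fedAvg s =>
    rw [kap, ← FLAlgorithm.one_sub_filter_mul_fedAvg, sub_sub_cancel, mul_comm (gam η φ x),
      mul_div_mul_right _ _ hγ, FLAlgorithm.steps]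
  | fedProx => simp [kap, FLAlgorithm.filter_fedProx, FLAlgorithm.steps]

lemma one_le_kap (hs : 1 ≤ alg.steps) (hγ : 0 < gam η φ x)
    (hadm : alg.StepAdmissible (gam η φ x)) : 1 ≤ kap alg η φ x := by
  rw [kap_eq_steps_div_filter alg hγ.ne', one_le_div (FLAlgorithm.filter_pos hs hγ.le hadm)]
  exact FLAlgorithm.filter_le_steps hγ.le hadm

lemma one_sub_roundOp (hN : total n ≠ 0) (alg : FLAlgorithm) (η : ℝ) (φ : 𝒳 → Coef d)
    (x : ∀ i, Fin (n i) → 𝒳) :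
    1 - roundOp alg η φ x = ∑ i, weight n i • (1 - localOp alg η φ (x i)) := by
  simp only [roundOp, smul_sub, Finset.sum_sub_distrib, ← Finset.sum_smul, sum_weight hN, one_smul]

lemma roundOp_nonneg (hη : 0 ≤ η) (hadm : alg.StepAdmissible (gam η φ x)) :
    0 ≤ roundOp alg η φ x := by
  simpa [roundOp] using sum_smul_le_sum_smul (weight_nonneg n) fun i =>
    localOp_nonneg hη (mul_norm_gram_le_gam hη φ x i) hadm

lemma filter_mul_smul_one_le_one_sub_roundOp (hη : 0 ≤ η) (hN : total n ≠ 0)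
    (hadm : alg.StepAdmissible (gam η φ x)) (hC : a • 1 ≤ pooledCovOp φ x) :
    (alg.filter (gam η φ x) * η * a) • 1 ≤ 1 - roundOp alg η φ x := by
  have hq := FLAlgorithm.filter_nonneg (gam_nonneg hη φ x) hadm
  calc (alg.filter (gam η φ x) * η * a) • (1 : Coef d →L[ℝ] Coef d)
      ≤ (alg.filter (gam η φ x) * η) • pooledCovOp φ x := by
        rw [mul_smul, ContinuousLinearMap.le_def, ← smul_sub]
        exact ((ContinuousLinearMap.le_def _ _).1 hC).smul_of_nonneg (mul_nonneg hq hη)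
    _ = ∑ i, weight n i • alg.filter (gam η φ x) • η • covOp φ (x i) := by
        simp only [pooledCovOp, Finset.smul_sum, mul_smul, smul_comm _ (weight n _)]
    _ ≤ ∑ i, weight n i • (1 - localOp alg η φ (x i)) :=
        sum_smul_le_sum_smul (weight_nonneg n) fun i =>
          filter_smul_covOp_le_one_sub_localOp hη (mul_norm_gram_le_gam hη φ x i) hadm
    _ = 1 - roundOp alg η φ x := (one_sub_roundOp hN alg η φ x).symm

lemma sum_inner_weight_smul_localPsi_sq_le (hη : 0 ≤ η) (hN : total n ≠ 0)
    (hadm : alg.StepAdmissible (gam η φ x)) (v : Coef d) :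
    ∑ k : Σ i, Fin (n i), inner ℝ v (weight n k.1 • localPsi alg η φ (x k.1) k.2) ^ 2
      ≤ η * alg.steps / total n * inner ℝ v ((1 - roundOp alg η φ x) v) := by
  simp only [one_sub_roundOp hN, sum_apply, inner_sum, smul_apply, inner_smul_right, mul_pow,
    Fintype.sum_sigma, ← Finset.mul_sum]
  rw [Finset.mul_sum]
  refine Finset.sum_le_sum fun i _ => ?_
  rw [← mul_assoc, ← weight_mul_div, mul_assoc]
  exact mul_le_mul_of_nonneg_left
    (sum_inner_localPsi_sq_le hη (mul_norm_gram_le_gam hη φ x i) hadm v) (sq_nonneg _)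

lemma globalModel_succ (hη : 0 < η) (y : ∀ i, Fin (n i) → ℝ) (θ₀ : Coef d) (t : ℕ) :
    globalModel alg η φ x y θ₀ (t + 1)
      = roundOp alg η φ x (globalModel alg η φ x y θ₀ t) + dotPsi alg η φ x y := by
  simp only [globalModel, localUpdate_eq _ _ _ hη, smul_add, Finset.sum_add_distrib, roundOp,
    sum_apply, smul_apply, dotPsi, Finset.smul_sum, smul_comm (weight n _)]

lemma dotPsi_response (θs : Fin M → Coef d) (z : ∀ i, Fin (n i) → ℝ) :
    dotPsi alg η φ x (response φ x θs z)
      = dotPsi alg η φ x (fun i j => modelValue φ (θs i) (x i j)) + dotPsi alg η φ x z := by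
  simp only [dotPsi, response, add_smul, Finset.sum_add_distrib]

lemma dotPsi_modelValue (hη : 0 ≤ η) (θs : Fin M → Coef d) :
    dotPsi alg η φ x (fun i j => modelValue φ (θs i) (x i j))
      = ∑ i, (weight n i • (1 - localOp alg η φ (x i))) (θs i) := by
  simp only [dotPsi, smul_comm _ (weight n _), ← Finset.smul_sum,
    sum_modelValue_smul_localPsi _ _ hη, smul_apply]

lemma map_dotPsi (T : Coef d →L[ℝ] Coef d) (z : ∀ i, Fin (n i) → ℝ) :
    T (dotPsi alg η φ x z)
      = ∑ k : Σ i, Fin (n i), z k.1 k.2 • T (weight n k.1 • localPsi alg η φ (x k.1) k.2) := by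
  simp only [dotPsi, map_sum, Fintype.sum_sigma, map_smul]

lemma one_sub_roundOp_thetaBar (hu : IsUnit (1 - roundOp alg η φ x)) (θs : Fin M → Coef d) :
    (1 - roundOp alg η φ x) (thetaBar alg η φ x θs)
      = dotPsi alg η φ x fun i j => modelValue φ (θs i) (x i j) :=
  congrArg (· (dotPsi alg η φ x fun i j => modelValue φ (θs i) (x i j)))
    (Ring.mul_inverse_cancel _ hu)

lemma globalModel_sub_thetaBar (hη : 0 < η) (hu : IsUnit (1 - roundOp alg η φ x))
    (θs : Fin M → Coef d) (z : ∀ i, Fin (n i) → ℝ) (θ₀ : Coef d) (t : ℕ) :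
    globalModel alg η φ x (response φ x θs z) θ₀ t - thetaBar alg η φ x θs
      = (roundOp alg η φ x ^ t) (θ₀ - thetaBar alg η φ x θs)
        + (∑ τ ∈ Finset.range t, roundOp alg η φ x ^ τ) (dotPsi alg η φ x z) := by
  have hfix := one_sub_roundOp_thetaBar hu θs
  rw [sub_apply, one_apply_eq_self] at hfix
  rw [← iterate_affine]
  induction t with
  | zero => rfl
  | succ t ih =>
    rw [Function.iterate_succ_apply', ← ih, globalModel_succ hη, dotPsi_response, ← hfix, map_sub]
    abel

end Round

section Error

variable {𝒳 : Type*} {d M : ℕ} {n : Fin M → ℕ} {alg : FLAlgorithm} {η a r σ : ℝ} {φ : 𝒳 → Coef d}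
  {x : ∀ i, Fin (n i) → 𝒳} {ν : Measure (∀ i, Fin (n i) → ℝ)}

lemma integrable_norm_globalModel_sub_thetaBar_sq (hη : 0 < η)
    (hu : IsUnit (1 - roundOp alg η φ x)) (hν : IsNoiseLaw σ ν) (θs : Fin M → Coef d)
    (θ₀ : Coef d) (t : ℕ) :
    Integrable (fun z => ‖globalModel alg η φ x (response φ x θs z) θ₀ t
      - thetaBar alg η φ x θs‖ ^ 2) ν := by
  have := hν.isProb
  simp_rw [globalModel_sub_thetaBar hη hu, map_dotPsi]
  exact integrable_norm_add_sum_smul_sq (fun k : Σ i, Fin (n i) => hν.memLp k.1 k.2) _ _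

lemma integral_norm_globalModel_sub_thetaBar_sq_le (hη : 0 < η) (hN : total n ≠ 0)
    (hadm : alg.StepAdmissible (gam η φ x)) (hr : 0 < r) (hround : r • 1 ≤ 1 - roundOp alg η φ x)
    (hν : IsNoiseLaw σ ν) (θs : Fin M → Coef d) (θ₀ : Coef d) (t : ℕ) :
    ∫ z, ‖globalModel alg η φ x (response φ x θs z) θ₀ t - thetaBar alg η φ x θs‖ ^ 2 ∂ν
      ≤ (1 - r) ^ (2 * t) * ‖θ₀ - thetaBar alg η φ x θs‖ ^ 2
        + σ ^ 2 * (η * alg.steps / total n * d / r) := by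
  have := hν.isProb
  have hL := roundOp_nonneg hη.le hadm
  simp_rw [globalModel_sub_thetaBar hη (isUnit_of_smul_one_le hr hround), map_dotPsi]
  rw [integral_norm_add_sum_smul_sq hν.indep (fun k => hν.memLp k.1 k.2)
    (fun k => hν.mean k.1 k.2)]
  refine add_le_add (norm_pow_apply_sq_le hL hround t _) ?_
  have hnoise := sum_norm_sq_geom_sum_apply_le hL hr hround (by positivity)
    (sum_inner_weight_smul_localPsi_sq_le hη.le hN hadm) t
  rw [finrank_euclideanSpace_fin] at hnoise
  refine le_trans ?_ (mul_le_mul_of_nonneg_left hnoise (sq_nonneg σ))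
  rw [Finset.mul_sum]
  exact Finset.sum_le_sum fun k _ => mul_le_mul_of_nonneg_right (hν.var k.1 k.2) (sq_nonneg _)

lemma inner_one_sub_roundOp_thetaBar_sub_le (hη : 0 ≤ η) (hN : total n ≠ 0)
    (hadm : alg.StepAdmissible (gam η φ x)) (hu : IsUnit (1 - roundOp alg η φ x))
    (θs : Fin M → Coef d) (θ : Coef d) :
    inner ℝ (thetaBar alg η φ x θs - θ)
        ((1 - roundOp alg η φ x) (thetaBar alg η φ x θs - θ))
      ≤ alg.steps * η * (1 / (total n : ℝ) * ∑ i, ∑ j, inner ℝ (φ (x i j)) (θs i - θ) ^ 2) := by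
  have hlocal i := one_sub_localOp_le_steps_smul_covOp hη (mul_norm_gram_le_gam hη φ x i) hadm
  have hpos i : 0 ≤ weight n i • (1 - localOp alg η φ (x i)) := by
    have := one_sub_localOp_nonneg hη (mul_norm_gram_le_gam hη φ x i) hadm
    rw [ContinuousLinearMap.nonneg_iff_isPositive] at this ⊢
    exact this.smul_of_nonneg (weight_nonneg n i)
  have hmean : (∑ i, weight n i • (1 - localOp alg η φ (x i))) (thetaBar alg η φ x θs - θ)
      = ∑ i, (weight n i • (1 - localOp alg η φ (x i))) (θs i - θ) := by
    rw [map_sub, ← one_sub_roundOp hN, one_sub_roundOp_thetaBar hu, one_sub_roundOp hN,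
      dotPsi_modelValue hη]
    simp only [sum_apply, map_sub, Finset.sum_sub_distrib]
  rw [one_sub_roundOp hN, ← sum_weight_mul_inner_covOp φ x fun i => θs i - θ, Finset.mul_sum]
  refine (inner_sum_apply_le_of_sum_apply_eq hpos hmean).trans (Finset.sum_le_sum fun i _ => ?_)
  have hi := inner_apply_mono (hlocal i) (θs i - θ)
  simp only [smul_apply, inner_smul_right] at hi ⊢
  rw [mul_left_comm, mul_assoc]
  exact mul_le_mul_of_nonneg_left hi (weight_nonneg n i)

lemma heterogeneity_nonneg (θs : Fin M → Coef d) : 0 ≤ heterogeneity θs :=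
  Real.iSup_nonneg fun _ => norm_nonneg _

lemma exists_norm_sub_le_heterogeneity (θs : Fin M → Coef d) :
    ∃ θ, ∀ i, ‖θs i - θ‖ ≤ heterogeneity θs := by
  rcases isEmpty_or_nonempty (Fin M) with hM | ⟨⟨i₀⟩⟩
  · exact ⟨0, isEmptyElim⟩
  · exact ⟨θs i₀, fun i => le_ciSup (f := fun p : Fin M × Fin M => ‖θs p.1 - θs p.2‖)
      (Set.finite_range _).bddAbove (i, i₀)⟩

variable (hη : 0 < η) (hs : 1 ≤ alg.steps) (hN : total n ≠ 0) (hγ : 0 < gam η φ x)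
  (hadm : alg.StepAdmissible (gam η φ x)) (hC : a • 1 ≤ pooledCovOp φ x)

include hη hs hN hγ hadm hC

lemma rate_smul_one_le_one_sub_roundOp :
    (alg.steps * η * a / kap alg η φ x) • 1 ≤ 1 - roundOp alg η φ x := by
  have hq := FLAlgorithm.filter_pos hs hγ.le hadm
  have : (0 : ℝ) < alg.steps := by positivity
  have hrate : alg.steps * η * a / kap alg η φ x = alg.filter (gam η φ x) * η * a := by
    rw [kap_eq_steps_div_filter alg hγ.ne']
    field_simp
  exact hrate ▸ filter_mul_smul_one_le_one_sub_roundOp hη.le hN hadm hC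

variable (ha : 0 < a)

include ha

lemma isUnit_one_sub_roundOp : IsUnit (1 - roundOp alg η φ x) := by
  have hκ := one_le_kap hs hγ hadm
  exact isUnit_of_smul_one_le (by positivity)
    (rate_smul_one_le_one_sub_roundOp hη hs hN hγ hadm hC)

lemma integral_norm_globalModel_sub_thetaBar_sq_le_kap (hν : IsNoiseLaw σ ν) (θs : Fin M → Coef d)
    (θ₀ : Coef d) (t : ℕ) :
    ∫ z, ‖globalModel alg η φ x (response φ x θs z) θ₀ t - thetaBar alg η φ x θs‖ ^ 2 ∂ν
      ≤ (1 - alg.steps * η * a / kap alg η φ x) ^ (2 * t) * ‖θ₀ - thetaBar alg η φ x θs‖ ^ 2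
        + σ ^ 2 * (kap alg η φ x * d / (total n * a)) := by
  have hκ := one_le_kap hs hγ hadm
  have : (0 : ℝ) < alg.steps := by positivity
  have hnoise : η * alg.steps / total n * d / (alg.steps * η * a / kap alg η φ x)
      = kap alg η φ x * d / (total n * a) := by
    field_simp
  exact hnoise ▸ integral_norm_globalModel_sub_thetaBar_sq_le hη hN hadm (by positivity)
    (rate_smul_one_le_one_sub_roundOp hη hs hN hγ hadm hC) hν θs θ₀ t

lemma mul_norm_thetaBar_sub_sq_le (θs : Fin M → Coef d) (θ : Coef d) :
    a * ‖thetaBar alg η φ x θs - θ‖ ^ 2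
      ≤ kap alg η φ x * (1 / (total n : ℝ) * ∑ i, ∑ j, inner ℝ (φ (x i j)) (θs i - θ) ^ 2) := by
  have hκ := one_le_kap hs hγ hadm
  have hlow := inner_apply_mono (rate_smul_one_le_one_sub_roundOp hη hs hN hγ hadm hC)
    (thetaBar alg η φ x θs - θ)
  rw [smul_apply, one_apply_eq_self, inner_smul_right, real_inner_self_eq_norm_sq] at hlow
  have hupp := inner_one_sub_roundOp_thetaBar_sub_le hη.le hN hadm
    (isUnit_one_sub_roundOp hη hs hN hγ hadm hC ha) θs θ
  have hsη : 0 < alg.steps * η := by positivity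
  refine le_of_mul_le_mul_left ?_ (div_pos hsη (one_pos.trans_le hκ))
  calc alg.steps * η / kap alg η φ x * (a * ‖thetaBar alg η φ x θs - θ‖ ^ 2)
      = alg.steps * η * a / kap alg η φ x * ‖thetaBar alg η φ x θs - θ‖ ^ 2 := by ring
    _ ≤ _ := hlow.trans hupp
    _ = _ := by field_simp

lemma norm_thetaBar_sub_le (θs : Fin M → Coef d) {θ : Coef d} {B G : ℝ} (hB : 0 ≤ B) (hG : 0 ≤ G)
    (hθ : ∀ i, ‖θs i - θ‖ ≤ G)
    (hsum : ∑ i, ∑ j, inner ℝ (φ (x i j)) (θs i - θ) ^ 2 ≤ total n * (B * G ^ 2)) (i : Fin M) :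
    ‖thetaBar alg η φ x θs - θs i‖ ≤ (√(B / a) + 1) * G * √(kap alg η φ x) := by
  have hκ := one_le_kap hs hγ hadm
  have hmean : 1 / (total n : ℝ) * ∑ i, ∑ j, inner ℝ (φ (x i j)) (θs i - θ) ^ 2 ≤ B * G ^ 2 := by
    rw [one_div_mul_eq_div, div_le_iff₀' (by positivity)]
    exact hsum
  have hdist : ‖thetaBar alg η φ x θs - θ‖ ≤ √(B / a) * G * √(kap alg η φ x) := by
    refine le_of_sq_le_sq ?_ (by positivity)
    rw [mul_pow, mul_pow, Real.sq_sqrt (by positivity), Real.sq_sqrt (by positivity)]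
    refine le_of_mul_le_mul_left ?_ ha
    calc a * ‖thetaBar alg η φ x θs - θ‖ ^ 2
        ≤ kap alg η φ x * (B * G ^ 2) :=
          (mul_norm_thetaBar_sub_sq_le hη hs hN hγ hadm hC ha θs θ).trans
            (mul_le_mul_of_nonneg_left hmean (by positivity))
      _ = a * (B / a * G ^ 2 * kap alg η φ x) := by field_simp
  calc ‖thetaBar alg η φ x θs - θs i‖
      ≤ ‖thetaBar alg η φ x θs - θ‖ + ‖θ - θs i‖ := norm_sub_le_norm_sub_add_norm_sub ..
    _ ≤ √(B / a) * G * √(kap alg η φ x) + G * √(kap alg η φ x) :=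
        add_le_add hdist ((norm_sub_rev _ _).trans_le ((hθ i).trans
          (le_mul_of_one_le_right hG (Real.one_le_sqrt.2 hκ))))
    _ = (√(B / a) + 1) * G * √(kap alg η φ x) := by ring

end Error

section Moments

variable {Ω : Type*} [MeasurableSpace Ω] {μ : Measure Ω} {L : ℝ} {X : Ω → ℝ}

/-- The random variable `X` is sub-exponential with norm at most `L`: `E exp(X / L) ≤ 2`. No
absolute value is taken, so for a variable that can be negative only the upper tail is controlled.
-/
structure SubExponential (L : ℝ) (X : Ω → ℝ) (μ : Measure Ω) : Prop where
  integrable_exp : Integrable (fun ω => Real.exp (X ω / L)) μ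
  integral_exp_le : ∫ ω, Real.exp (X ω / L) ∂μ ≤ 2

lemma pow_le_factorial_mul_exp_div (hL : 0 < L) {y : ℝ} (hy : 0 ≤ y) (p : ℕ) :
    y ^ p ≤ p.factorial * L ^ p * Real.exp (y / L) := by
  have h := Real.pow_div_factorial_le_exp (y / L) (div_nonneg hy hL.le) p
  rw [div_pow, div_div, div_le_iff₀ (by positivity)] at h
  linarith

lemma SubExponential.aemeasurable (h : SubExponential L X μ) (hL : L ≠ 0) : AEMeasurable X μ := by
  have hdiv := (Real.aemeasurable_of_aemeasurable_exp h.integrable_exp.1.aemeasurable).mul_const L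
  simpa only [div_mul_cancel₀ _ hL] using hdiv

lemma SubExponential.integrable_pow (h : SubExponential L X μ) (hL : 0 < L) (h0 : ∀ ω, 0 ≤ X ω)
    (p : ℕ) : Integrable (fun ω => X ω ^ p) μ :=
  (h.integrable_exp.const_mul _).mono' ((h.aemeasurable hL.ne').pow_const p).aestronglyMeasurable
    (ae_of_all _ fun ω => (Real.norm_of_nonneg (pow_nonneg (h0 ω) p)).trans_le
      (pow_le_factorial_mul_exp_div hL (h0 ω) p))

lemma SubExponential.integral_pow_le (h : SubExponential L X μ) (hL : 0 < L) (h0 : ∀ ω, 0 ≤ X ω)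
    (p : ℕ) : ∫ ω, X ω ^ p ∂μ ≤ 2 * p.factorial * L ^ p :=
  calc ∫ ω, X ω ^ p ∂μ
      ≤ ∫ ω, p.factorial * L ^ p * Real.exp (X ω / L) ∂μ :=
        integral_mono (h.integrable_pow hL h0 p) (h.integrable_exp.const_mul _)
          fun ω => pow_le_factorial_mul_exp_div hL (h0 ω) p
    _ = p.factorial * L ^ p * ∫ ω, Real.exp (X ω / L) ∂μ := integral_const_mul _ _
    _ ≤ p.factorial * L ^ p * 2 :=
        mul_le_mul_of_nonneg_left h.integral_exp_le (by positivity)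
    _ = 2 * p.factorial * L ^ p := by ring

lemma exp_neg_le_one_sub_add_sq_div_two {y : ℝ} (hy : 0 ≤ y) :
    Real.exp (-y) ≤ 1 - y + y ^ 2 / 2 := by
  have hexp := Real.quadratic_le_exp_of_nonneg hy
  have hpos : 0 < 1 - y + y ^ 2 / 2 := by nlinarith [sq_nonneg (y - 1)]
  rw [Real.exp_neg, inv_le_iff_one_le_mul₀ (Real.exp_pos y)]
  nlinarith [mul_le_mul_of_nonneg_left hexp hpos.le, sq_nonneg (y ^ 2)]

lemma integrable_exp_neg_mul [IsFiniteMeasure μ] (hX : AEMeasurable X μ) (h0 : ∀ ω, 0 ≤ X ω)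
    {t : ℝ} (ht : 0 ≤ t) : Integrable (fun ω => Real.exp (-t * X ω)) μ :=
  (integrable_const (1 : ℝ)).mono' (hX.const_mul _).exp.aestronglyMeasurable
    (ae_of_all _ fun ω => (Real.norm_of_nonneg (Real.exp_pos _).le).trans_le
      (Real.exp_le_one_iff.2 (mul_nonpos_of_nonpos_of_nonneg (neg_nonpos.2 ht) (h0 ω))))

lemma mgf_neg_le [IsProbabilityMeasure μ] (hX : MemLp X 2 μ) (h0 : ∀ ω, 0 ≤ X ω) {t a b : ℝ}
    (ht : 0 ≤ t) (hmean : a ≤ ∫ ω, X ω ∂μ) (hsq : ∫ ω, X ω ^ 2 ∂μ ≤ b) :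
    mgf X μ (-t) ≤ Real.exp (-t * a + t ^ 2 / 2 * b) := by
  have hint : Integrable X μ := hX.integrable one_le_two
  have hlin : Integrable (fun ω => 1 - t * X ω) μ := (integrable_const _).sub (hint.const_mul t)
  have hquad : Integrable (fun ω => t ^ 2 / 2 * X ω ^ 2) μ := hX.integrable_sq.const_mul _
  have hpoint ω : Real.exp (-t * X ω) ≤ 1 - t * X ω + t ^ 2 / 2 * X ω ^ 2 := by
    have := exp_neg_le_one_sub_add_sq_div_two (mul_nonneg ht (h0 ω))
    rw [neg_mul]
    linarith [mul_pow t (X ω) 2]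
  calc mgf X μ (-t)
      ≤ ∫ ω, 1 - t * X ω + t ^ 2 / 2 * X ω ^ 2 ∂μ :=
        integral_mono (integrable_exp_neg_mul hint.1.aemeasurable h0 ht) (hlin.add hquad) hpoint
    _ = 1 - t * ∫ ω, X ω ∂μ + t ^ 2 / 2 * ∫ ω, X ω ^ 2 ∂μ := by
        rw [integral_add hlin hquad, integral_sub (integrable_const _) (hint.const_mul t),
          integral_const_mul, integral_const_mul, integral_const, probReal_univ, one_smul]
    _ ≤ (-t * a + t ^ 2 / 2 * b) + 1 := by
        have := mul_le_mul_of_nonneg_left hmean ht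
        have := mul_le_mul_of_nonneg_left hsq (by positivity : 0 ≤ t ^ 2 / 2)
        linarith
    _ ≤ Real.exp (-t * a + t ^ 2 / 2 * b) := Real.add_one_le_exp _

end Moments

section Tails

variable {Ω ι : Type*} [MeasurableSpace Ω] [Fintype ι] {μ : Measure Ω} {X : ι → Ω → ℝ}

lemma mgf_sum_le_exp (hX : ∀ k, Measurable (X k)) (hind : iIndepFun X μ) {t c : ℝ}
    (h : ∀ k, mgf (X k) μ t ≤ Real.exp c) :
    mgf (∑ k, X k) μ t ≤ Real.exp (Fintype.card ι * c) := by
  rw [hind.mgf_sum hX, Real.exp_nat_mul, ← Finset.card_univ, ← Finset.prod_const]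
  exact Finset.prod_le_prod (fun k _ => mgf_nonneg) fun k _ => h k

variable [IsProbabilityMeasure μ]

lemma measureReal_card_mul_le_sum_le (hX : ∀ k, Measurable (X k)) (hind : iIndepFun X μ) {L : ℝ}
    (hL : 0 < L) (hsub : ∀ k, SubExponential L (X k) μ) (c : ℝ) :
    μ.real {ω | Fintype.card ι * (L * (Real.log 2 + c)) ≤ ∑ k, X k ω}
      ≤ Real.exp (-(c * Fintype.card ι)) := by
  have hint k : Integrable (fun ω => Real.exp (L⁻¹ * X k ω)) μ := by
    simpa only [div_eq_inv_mul] using (hsub k).integrable_exp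
  have hmgf k : mgf (X k) μ L⁻¹ ≤ Real.exp (Real.log 2) := by
    simpa only [mgf, div_eq_inv_mul, Real.exp_log two_pos] using (hsub k).integral_exp_le
  have hchernoff := measure_ge_le_exp_mul_mgf (X := ∑ k, X k)
    (Fintype.card ι * (L * (Real.log 2 + c))) (inv_nonneg.2 hL.le)
    (hind.integrable_exp_mul_sum hX fun k _ => hint k)
  simp only [Finset.sum_apply] at hchernoff
  refine (hchernoff.trans (mul_le_mul_of_nonneg_left (mgf_sum_le_exp hX hind hmgf)
    (Real.exp_pos _).le)).trans_eq ?_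
  rw [← Real.exp_add]
  congr 1
  field_simp
  ring

lemma measureReal_sum_le_card_mul_le (hX : ∀ k, Measurable (X k)) (hind : iIndepFun X μ)
    (hL2 : ∀ k, MemLp (X k) 2 μ) (h0 : ∀ k ω, 0 ≤ X k ω) {a b δ : ℝ} (hb : 0 < b) (hδ : 0 ≤ δ)
    (hmean : ∀ k, a ≤ ∫ ω, X k ω ∂μ) (hsq : ∀ k, ∫ ω, X k ω ^ 2 ∂μ ≤ b) :
    μ.real {ω | ∑ k, X k ω ≤ Fintype.card ι * (a - δ)}
      ≤ Real.exp (-(δ ^ 2 / (2 * b) * Fintype.card ι)) := by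
  -- `t = δ / b` minimizes the Chernoff exponent `-t * δ + t ^ 2 * b / 2`.
  have ht : 0 ≤ δ / b := div_nonneg hδ hb.le
  have hchernoff := measure_le_le_exp_mul_mgf (X := ∑ k, X k) (Fintype.card ι * (a - δ))
    (neg_nonpos.2 ht) (hind.integrable_exp_mul_sum hX
      fun k _ => integrable_exp_neg_mul (hX k).aemeasurable (h0 k) ht)
  simp only [Finset.sum_apply] at hchernoff
  refine (hchernoff.trans (mul_le_mul_of_nonneg_left (mgf_sum_le_exp hX hind fun k =>
    mgf_neg_le (hL2 k) (h0 k) ht (hmean k) (hsq k)) (Real.exp_pos _).le)).trans_eq ?_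
  rw [← Real.exp_add]
  congr 1
  field_simp
  ring

end Tails

section SecondMoment

variable {Ω : Type*} [MeasurableSpace Ω] {μ : Measure Ω} {d : ℕ} {V : Ω → Coef d} {K : ℝ}

lemma SubGaussianVec.lintegral_exp_inner_sq_le [IsProbabilityMeasure μ]
    (h : SubGaussianVec K V μ) {u : Coef d} {G : ℝ} (hu : ‖u‖ ≤ G) :
    ∫⁻ ω, ENNReal.ofReal (Real.exp (inner ℝ (V ω) u ^ 2 / (K ^ 2 * G ^ 2))) ∂μ ≤ 2 := by
  rcases eq_or_ne u 0 with rfl | hu0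
  · simp
  have hn : 0 < ‖u‖ := norm_pos_iff.2 hu0
  have hunit : ‖‖u‖⁻¹ • u‖ = 1 := by rw [norm_smul, norm_inv, norm_norm, inv_mul_cancel₀ hn.ne']
  refine (lintegral_mono fun ω => ENNReal.ofReal_le_ofReal (Real.exp_le_exp.2 ?_)).trans
    (h _ hunit)
  calc inner ℝ (V ω) u ^ 2 / (K ^ 2 * G ^ 2)
      = (G ^ 2)⁻¹ * (inner ℝ (V ω) u ^ 2 / K ^ 2) := by rw [mul_comm (K ^ 2), ← div_div]; ring
    _ ≤ (‖u‖ ^ 2)⁻¹ * (inner ℝ (V ω) u ^ 2 / K ^ 2) := by gcongr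
    _ = inner ℝ (‖u‖⁻¹ • u) (V ω) ^ 2 / K ^ 2 := by
        rw [real_inner_smul_left, real_inner_comm, mul_pow, inv_pow, mul_div_assoc]

lemma SubGaussianVec.subExponential_inner_sq [IsProbabilityMeasure μ] (hV : Measurable V)
    (h : SubGaussianVec K V μ) {u : Coef d} {G : ℝ} (hu : ‖u‖ ≤ G) :
    SubExponential (K ^ 2 * G ^ 2) (fun ω => inner ℝ (V ω) u ^ 2) μ := by
  have hmeas : AEStronglyMeasurable
      (fun ω => Real.exp (inner ℝ (V ω) u ^ 2 / (K ^ 2 * G ^ 2))) μ := by fun_prop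
  have hpos : 0 ≤ᵐ[μ] fun ω => Real.exp (inner ℝ (V ω) u ^ 2 / (K ^ 2 * G ^ 2)) :=
    ae_of_all _ fun ω => (Real.exp_pos _).le
  have hle := h.lintegral_exp_inner_sq_le hu
  constructor
  · exact ⟨hmeas, (hasFiniteIntegral_iff_ofReal hpos).2 (hle.trans_lt ENNReal.ofNat_lt_top)⟩
  · rw [integral_eq_lintegral_of_nonneg_ae hpos hmeas]
    exact ENNReal.toReal_le_of_le_ofReal zero_le_two (by simpa using hle)

lemma SubGaussianVec.memLp_two [IsProbabilityMeasure μ] (hK : K ≠ 0) (hV : Measurable V)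
    (h : SubGaussianVec K V μ) : MemLp V 2 μ := by
  refine MemLp.of_eval_piLp fun a => (memLp_two_iff_integrable_sq (by fun_prop)).2 ?_
  have hsub := h.subExponential_inner_sq hV (u := EuclideanSpace.single a 1) (G := 1) (by simp)
  simpa [EuclideanSpace.inner_single_right] using
    hsub.integrable_pow (by positivity) (fun ω => sq_nonneg _) 1

lemma dotProduct_secondMoment_mulVec (hV : MemLp V 2 μ) (u : Coef d) :
    u.ofLp ⬝ᵥ (secondMoment V μ).mulVec u.ofLp = ∫ ω, inner ℝ (V ω) u ^ 2 ∂μ := by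
  have hprod a b : Integrable (fun ω => V ω a * V ω b) μ :=
    (hV.eval_piLp a).integrable_mul (hV.eval_piLp b)
  have hexpand ω : inner ℝ (V ω) u ^ 2 = ∑ a, ∑ b, V ω a * V ω b * (u a * u b) := by
    rw [PiLp.inner_apply, sq, Finset.sum_mul_sum]
    refine Finset.sum_congr rfl fun a _ => Finset.sum_congr rfl fun b _ => ?_
    simp only [RCLike.inner_apply, conj_trivial]
    ring
  simp_rw [hexpand]
  rw [integral_finsetSum _ fun a _ => integrable_finsetSum _ fun b _ => (hprod a b).mul_const _]
  simp_rw [integral_finsetSum _ fun b _ => (hprod _ b).mul_const _, integral_mul_const]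
  simp only [dotProduct, Matrix.mulVec, secondMoment, Matrix.of_apply, Finset.mul_sum]
  exact Finset.sum_congr rfl fun a _ => Finset.sum_congr rfl fun b _ => by ring

lemma mul_norm_sq_le_integral_inner_sq (hV : MemLp V 2 μ) {α : ℝ}
    (hα : (secondMoment V μ - α • 1).PosSemidef) (u : Coef d) :
    α * ‖u‖ ^ 2 ≤ ∫ ω, inner ℝ (V ω) u ^ 2 ∂μ := by
  have hu : u.ofLp ⬝ᵥ u.ofLp = ‖u‖ ^ 2 := by
    rw [← real_inner_self_eq_norm_sq, EuclideanSpace.inner_eq_star_dotProduct, star_trivial]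
  have h := hα.dotProduct_mulVec_nonneg u.ofLp
  rw [star_trivial, Matrix.sub_mulVec, dotProduct_sub, dotProduct_secondMoment_mulVec hV,
    Matrix.smul_mulVec, Matrix.one_mulVec, dotProduct_smul, hu, smul_eq_mul] at h
  exact sub_nonneg.1 h

end SecondMoment

open Metric Module

open scoped NNReal ENNReal

section Net

variable {E : Type*} [NormedAddCommGroup E] [NormedSpace ℝ E] [FiniteDimensional ℝ E]

lemma card_le_pow_finrank_of_isSeparated {ε : ℝ≥0} (hε : 0 < ε) {S : Finset E}
    (hS : (S : Set E) ⊆ sphere 0 1) (hsep : IsSeparated ε (S : Set E)) :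
    (S.card : ℝ) ≤ (1 + 2 / ε) ^ finrank ℝ E := by
  borelize E
  let μ : Measure E := Measure.addHaar
  have hr : (0 : ℝ) < ε / 2 := by positivity
  have hR : (0 : ℝ) < 1 + ε / 2 := by positivity
  have hdisj : (S : Set E).PairwiseDisjoint fun c => ball c (ε / 2 : ℝ) := fun c hc c' hc' hne => by
    refine ball_disjoint_ball ?_
    have hlt : (ε : ℝ≥0∞) < edist c c' := hsep hc hc' hne
    rw [edist_nndist, ENNReal.coe_lt_coe] at hlt
    rw [add_halves, ← coe_nndist]
    exact_mod_cast hlt.le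
  have hsub : (⋃ c ∈ S, ball c (ε / 2 : ℝ)) ⊆ ball 0 (1 + ε / 2) :=
    Set.iUnion₂_subset fun c hc =>
      ball_subset_ball' (by rw [mem_sphere.1 (hS hc), add_comm])
  have hvol := measure_mono (μ := μ) hsub
  rw [measure_biUnion_finset hdisj fun c _ => measurableSet_ball] at hvol
  simp only [μ.addHaar_ball_of_pos _ hr, μ.addHaar_ball_of_pos _ hR, Finset.sum_const,
    nsmul_eq_mul, ← mul_assoc] at hvol
  have hcard : (S.card : ℝ≥0∞) * ENNReal.ofReal ((ε / 2 : ℝ) ^ finrank ℝ E)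
      ≤ ENNReal.ofReal ((1 + ε / 2 : ℝ) ^ finrank ℝ E) :=
    (ENNReal.mul_le_mul_iff_left (measure_ball_pos _ _ zero_lt_one).ne'
      measure_ball_lt_top.ne).1 hvol
  have hreal := ENNReal.toReal_le_of_le_ofReal (by positivity) hcard
  rw [ENNReal.toReal_mul, ENNReal.toReal_natCast, ENNReal.toReal_ofReal (by positivity)] at hreal
  rw [show 1 + 2 / (ε : ℝ) = (1 + ε / 2) / (ε / 2) by field_simp; ring, div_pow,
    le_div_iff₀ (by positivity)]
  exact hreal

lemma packingNumber_ne_top_of_isCompact {X : Type*} [PseudoEMetricSpace X] {A : Set X}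
    (hA : IsCompact A) {ε : ℝ≥0} (hε : ε ≠ 0) : packingNumber ε A ≠ ⊤ := by
  obtain ⟨C, -, hC, hcover⟩ := exists_finite_isCover_of_isCompact (half_pos hε.bot_lt).ne' hA
  have hpack := packingNumber_two_mul_le_externalCoveringNumber (ε / 2) A
  rw [mul_div_cancel₀ _ two_ne_zero] at hpack
  exact ((hpack.trans hcover.externalCoveringNumber_le_encard).trans_lt hC.encard_lt_top).ne

variable (E) in
lemma exists_isCover_sphere_card_le {ε : ℝ≥0} (hε : 0 < ε) :
    ∃ S : Finset E, (S : Set E) ⊆ sphere 0 1 ∧ IsCover ε (sphere 0 1) (S : Set E) ∧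
      (S.card : ℝ) ≤ (1 + 2 / ε) ^ finrank ℝ E := by
  have hpack := packingNumber_ne_top_of_isCompact (isCompact_sphere (0 : E) 1) hε.ne'
  have hfin : (maximalSeparatedSet ε (sphere (0 : E) 1)).Finite := by
    rwa [← Set.encard_ne_top_iff, encard_maximalSeparatedSet hpack]
  obtain ⟨S, hS⟩ := hfin.exists_finset_coe
  have hsub : (S : Set E) ⊆ sphere 0 1 := hS.trans_subset maximalSeparatedSet_subset
  exact ⟨S, hsub, hS ▸ isCover_maximalSeparatedSet hpack,
    card_le_pow_finrank_of_isSeparated hε hsub (hS ▸ isSeparated_maximalSeparatedSet)⟩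

end Net

section LowerBound

variable {E F : Type*} [NormedAddCommGroup E] [NormedSpace ℝ E] [NormedAddCommGroup F]
  [NormedSpace ℝ F] {S : Set E} {ε : ℝ≥0} {hi : ℝ}

lemma exists_mem_norm_map_sub_le_of_isCover (A : E →L[ℝ] F) (hS : IsCover ε (sphere 0 1) S)
    {w : E} (hw : ‖w‖ = 1) : ∃ u ∈ S, ‖A w - A u‖ ≤ ‖A‖ * ε := by
  obtain ⟨u, hu, hwu⟩ := Set.mem_iUnion₂.1
    (hS.subset_iUnion_closedBall (mem_sphere_zero_iff_norm.2 hw))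
  refine ⟨u, hu, ?_⟩
  rw [← map_sub]
  exact A.le_opNorm_of_le (mem_closedBall_iff_norm.1 hwu)

lemma opNorm_le_of_isCover_sphere (A : E →L[ℝ] F) (hε : ε ≤ 1 / 2)
    (hS : IsCover ε (sphere 0 1) S) (hhi : 0 ≤ hi) (hA : ∀ u ∈ S, ‖A u‖ ≤ hi) : ‖A‖ ≤ 2 * hi := by
  have : (ε : ℝ) ≤ 1 / 2 := by exact_mod_cast hε
  have hnorm : ‖A‖ ≤ hi + ‖A‖ * ε := by
    refine A.opNorm_le_of_unit_norm (by positivity) fun w hw => ?_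
    obtain ⟨u, hu, hwu⟩ := exists_mem_norm_map_sub_le_of_isCover A hS hw
    linarith [norm_le_norm_add_norm_sub' (A w) (A u), hA u hu]
  nlinarith [norm_nonneg A]

lemma sub_le_norm_of_isCover_sphere (A : E →L[ℝ] F) (hε : ε ≤ 1 / 2)
    (hS : IsCover ε (sphere 0 1) S) {lo : ℝ} (hhi : 0 ≤ hi)
    (hA : ∀ u ∈ S, lo ≤ ‖A u‖ ∧ ‖A u‖ ≤ hi) {w : E} (hw : ‖w‖ = 1) :
    lo - 2 * hi * ε ≤ ‖A w‖ := by
  obtain ⟨u, hu, hwu⟩ := exists_mem_norm_map_sub_le_of_isCover A hS hw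
  have hnorm := mul_le_mul_of_nonneg_right
    (opNorm_le_of_isCover_sphere A hε hS hhi fun u hu => (hA u hu).2) ε.coe_nonneg
  linarith [norm_le_norm_add_norm_sub (A w) (A u), (hA u hu).1]

end LowerBound

section FrameBound

variable {E ι : Type*} [NormedAddCommGroup E] [InnerProductSpace ℝ E] [Fintype ι]

/-- The analysis operator `v ↦ (⟨V k, v⟩)_k` of a finite family of vectors. Its squared norm at `v`
is the quadratic form whose smallest value on the sphere has to be bounded below. -/
noncomputable def analysisOp (V : ι → E) : E →L[ℝ] EuclideanSpace ℝ ι :=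
  (PiLp.continuousLinearEquiv 2 ℝ (fun _ : ι => ℝ)).symm.toContinuousLinearMap.comp
    (ContinuousLinearMap.pi fun k => innerSL ℝ (V k))

lemma norm_analysisOp_sq (V : ι → E) (v : E) :
    ‖analysisOp V v‖ ^ 2 = ∑ k, inner ℝ (V k) v ^ 2 := by
  simp [EuclideanSpace.norm_sq_eq, analysisOp]

lemma mul_norm_sq_le_sum_inner_sq_of_isCover_sphere {V : ι → E} {S : Set E} {ε : ℝ≥0} {a b B : ℝ}
    (hε : ε ≤ 1 / 2) (hS : IsCover ε (sphere 0 1) S) (hgap : √a + 2 * √B * ε ≤ √b)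
    (hV : ∀ u ∈ S, b ≤ ∑ k, inner ℝ (V k) u ^ 2 ∧ ∑ k, inner ℝ (V k) u ^ 2 ≤ B) (v : E) :
    a * ‖v‖ ^ 2 ≤ ∑ k, inner ℝ (V k) v ^ 2 := by
  have hnet u (hu : u ∈ S) : √b ≤ ‖analysisOp V u‖ ∧ ‖analysisOp V u‖ ≤ √B := by
    rw [Real.sqrt_le_left (norm_nonneg _), norm_analysisOp_sq]
    exact ⟨(hV u hu).1, Real.le_sqrt_of_sq_le ((norm_analysisOp_sq V u).trans_le (hV u hu).2)⟩
  have hunit w (hw : ‖w‖ = 1) : √a ≤ ‖analysisOp V w‖ := by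
    linarith [sub_le_norm_of_isCover_sphere _ hε hS (Real.sqrt_nonneg B) hnet hw]
  rcases eq_or_ne v 0 with rfl | hv
  · simp
  have hn : 0 < ‖v‖ := norm_pos_iff.2 hv
  have h := hunit (‖v‖⁻¹ • v) (by rw [norm_smul, norm_inv, norm_norm, inv_mul_cancel₀ hn.ne'])
  rw [Real.sqrt_le_left (norm_nonneg _), map_smul, norm_smul, norm_inv, norm_norm, mul_pow,
    inv_pow, norm_analysisOp_sq, le_inv_mul_iff₀ (by positivity)] at h
  rwa [mul_comm]

lemma exists_sqrt_add_two_mul_sqrt_mul_le {a b : ℝ} (hb : 0 < b) (hab : a < b) (B : ℝ) :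
    ∃ ε : ℝ≥0, 0 < ε ∧ ε ≤ 1 / 2 ∧ √a + 2 * √B * ε ≤ √b := by
  obtain ⟨δ, hδ, hlt⟩ := exists_pos_mul_lt
    (sub_pos.2 ((Real.sqrt_lt_sqrt_iff_of_pos hb).2 hab)) (2 * √B)
  lift δ to ℝ≥0 using hδ.le
  refine ⟨min (1 / 2) δ, lt_min (by positivity) hδ, min_le_left _ _, ?_⟩
  have hmin : ((min (1 / 2) δ : ℝ≥0) : ℝ) ≤ δ := NNReal.coe_le_coe.2 (min_le_right _ _)
  linarith [mul_le_mul_of_nonneg_left hmin (by positivity : 0 ≤ 2 * √B)]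

end FrameBound

section Events

variable {Ω ι : Type*} [MeasurableSpace Ω] {μ : Measure Ω} {d : ℕ} {V : ι → Ω → Coef d} {K α : ℝ}

lemma iIndepFun_inner_sq (hind : iIndepFun V μ) (u : ι → Coef d) :
    iIndepFun (fun k ω => inner ℝ (V k ω) (u k) ^ 2) μ :=
  hind.comp (fun k v => inner ℝ v (u k) ^ 2) fun k => by fun_prop

variable [Fintype ι] [IsProbabilityMeasure μ] (hK : 0 < K) (hV : ∀ k, Measurable (V k))
  (hind : iIndepFun V μ) (hsub : ∀ k, SubGaussianVec K (V k) μ)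

include hK hV hind hsub

lemma measureReal_card_mul_le_sum_inner_sq_le {u : ι → Coef d} {G : ℝ} (hG : 0 < G)
    (hu : ∀ k, ‖u k‖ ≤ G) (c : ℝ) :
    μ.real {ω | Fintype.card ι * (K ^ 2 * G ^ 2 * (Real.log 2 + c))
        ≤ ∑ k, inner ℝ (V k ω) (u k) ^ 2}
      ≤ Real.exp (-(c * Fintype.card ι)) :=
  measureReal_card_mul_le_sum_le (fun k => by have := hV k; fun_prop) (iIndepFun_inner_sq hind u)
    (by positivity) (fun k => (hsub k).subExponential_inner_sq (hV k) (hu k)) c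

lemma measureReal_sum_inner_sq_le_card_mul_le (hα : 0 ≤ α)
    (hpsd : ∀ k, (secondMoment (V k) μ - α • 1).PosSemidef) {u : Coef d} (hu : ‖u‖ = 1) :
    μ.real {ω | ∑ k, inner ℝ (V k ω) u ^ 2 ≤ Fintype.card ι * (3 / 4 * α)}
      ≤ Real.exp (-(α ^ 2 / (128 * K ^ 4) * Fintype.card ι)) := by
  have hmeas k : Measurable fun ω => inner ℝ (V k ω) u ^ 2 := by
    have := hV k
    fun_prop
  have hexp k := (hsub k).subExponential_inner_sq (hV k) hu.le
  have hsq k := (hexp k).integrable_pow (by positivity) (fun ω => sq_nonneg _) 2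
  have hmean k : α ≤ ∫ ω, inner ℝ (V k ω) u ^ 2 ∂μ := by
    simpa [hu] using
      mul_norm_sq_le_integral_inner_sq ((hsub k).memLp_two hK.ne' (hV k)) (hpsd k) u
  have hsq_le k : ∫ ω, (inner ℝ (V k ω) u ^ 2) ^ 2 ∂μ ≤ 4 * K ^ 4 := by
    refine ((hexp k).integral_pow_le (by positivity) (fun ω => sq_nonneg _) 2).trans_eq ?_
    norm_num
    ring
  have h := measureReal_sum_le_card_mul_le hmeas (iIndepFun_inner_sq hind fun _ => u)
    (fun k => (memLp_two_iff_integrable_sq (hmeas k).aestronglyMeasurable).2 (hsq k))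
    (fun k ω => sq_nonneg _) (by positivity) (by positivity : 0 ≤ α / 4) hmean hsq_le
  convert h using 3 <;> ring_nf

lemma exists_event_forall_mem_sum_inner_sq_bounds (hα : 0 ≤ α)
    (hpsd : ∀ k, (secondMoment (V k) μ - α • 1).PosSemidef) {c : ℝ}
    (hc : c = α ^ 2 / (128 * K ^ 4)) {S : Finset (Coef d)} (hS : (S : Set (Coef d)) ⊆ sphere 0 1) :
    ∃ E, MeasurableSet E ∧ 1 - S.card * (2 * Real.exp (-(c * Fintype.card ι))) ≤ μ.real E ∧
      ∀ ω ∈ E, ∀ u ∈ S, Fintype.card ι * (3 / 4 * α) ≤ ∑ k, inner ℝ (V k ω) u ^ 2 ∧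
        ∑ k, inner ℝ (V k ω) u ^ 2 ≤ Fintype.card ι * (K ^ 2 * (Real.log 2 + c)) := by
  let low (u : Coef d) := {ω | ∑ k, inner ℝ (V k ω) u ^ 2 ≤ Fintype.card ι * (3 / 4 * α)}
  let high (u : Coef d) :=
    {ω | Fintype.card ι * (K ^ 2 * (Real.log 2 + c)) ≤ ∑ k, inner ℝ (V k ω) u ^ 2}
  have hsum u : Measurable fun ω => ∑ k, inner ℝ (V k ω) u ^ 2 := by fun_prop
  have hmeas : MeasurableSet (⋃ u ∈ S, low u ∪ high u) :=
    S.measurableSet_biUnion fun u _ => (measurableSet_le (hsum u) measurable_const).union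
      (measurableSet_le measurable_const (hsum u))
  have hbad u (hu : u ∈ S) : μ.real (low u ∪ high u) ≤ 2 * Real.exp (-(c * Fintype.card ι)) := by
    have hu1 : ‖u‖ = 1 := mem_sphere_zero_iff_norm.1 (hS hu)
    have hlow := measureReal_sum_inner_sq_le_card_mul_le hK hV hind hsub hα hpsd hu1
    have hhigh := measureReal_card_mul_le_sum_inner_sq_le hK hV hind hsub one_pos
      (fun _ : ι => hu1.le) c
    rw [one_pow, mul_one] at hhigh
    rw [two_mul]
    exact (measureReal_union_le _ _).trans (add_le_add (hc ▸ hlow) hhigh)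
  refine ⟨(⋃ u ∈ S, low u ∪ high u)ᶜ, hmeas.compl, ?_, fun ω hω u hu => ?_⟩
  · rw [probReal_compl_eq_one_sub hmeas, ← nsmul_eq_mul]
    exact sub_le_sub_left ((measureReal_biUnion_finset_le _ _).trans
      (Finset.sum_le_card_nsmul _ _ _ hbad)) 1
  · have hgood : ω ∉ low u ∪ high u := fun h => hω (Set.mem_biUnion hu h)
    simp only [low, high, Set.mem_union, Set.mem_ofPred_eq, not_or, not_le] at hgood
    exact ⟨hgood.1.le, hgood.2.le⟩

lemma exists_event_sum_inner_sq_le {u : ι → Coef d} {G : ℝ} (hG : 0 ≤ G) (hu : ∀ k, ‖u k‖ ≤ G) :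
    ∃ E, MeasurableSet E ∧ 1 - Real.exp (-(Fintype.card ι : ℝ)) ≤ μ.real E ∧
      ∀ ω ∈ E, ∑ k, inner ℝ (V k ω) (u k) ^ 2
        ≤ Fintype.card ι * (K ^ 2 * (Real.log 2 + 1) * G ^ 2) := by
  rcases hG.eq_or_lt with rfl | hG
  · have hu0 k : u k = 0 := norm_le_zero_iff.1 (hu k)
    exact ⟨Set.univ, MeasurableSet.univ, by simp [Real.exp_nonneg], fun ω _ => by simp [hu0]⟩
  have hmeas : MeasurableSet {ω | Fintype.card ι * (K ^ 2 * G ^ 2 * (Real.log 2 + 1))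
      ≤ ∑ k, inner ℝ (V k ω) (u k) ^ 2} := measurableSet_le measurable_const (by fun_prop)
  have hprob := measureReal_card_mul_le_sum_inner_sq_le hK hV hind hsub hG hu 1
  rw [one_mul] at hprob
  refine ⟨_, hmeas.compl, ?_, fun ω hω => ?_⟩
  · rw [probReal_compl_eq_one_sub hmeas]
    exact sub_le_sub_left hprob 1
  · rw [Set.mem_compl_iff, Set.mem_ofPred_eq, not_le] at hω
    rw [mul_right_comm]
    exact hω.le

end Events

lemma pow_mul_two_mul_exp_neg_le {A x : ℝ} (hA : 0 < A) {d : ℕ} (hd : d ≠ 0)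
    (hx : Real.log (2 * A) * d ≤ x / 2) : A ^ d * (2 * Real.exp (-x)) ≤ Real.exp (-(x / 2)) :=
  calc A ^ d * (2 * Real.exp (-x))
      ≤ A ^ d * (2 ^ d * Real.exp (-x)) := by
        gcongr
        exact le_self_pow₀ one_le_two hd
    _ = Real.exp (Real.log (2 * A) * d - x) := by
        rw [sub_eq_add_neg, Real.exp_add, mul_comm (Real.log _), Real.exp_nat_mul,
          Real.exp_log (by positivity), mul_pow]
        ring
    _ ≤ Real.exp (-(x / 2)) := Real.exp_le_exp.2 (by linarith)

lemma exists_event_card_mul_norm_sq_le_sum_inner_sq {α K : ℝ} (hα : 0 < α) (hK : 0 < K) :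
    ∃ c₁ c₃ : ℝ, 0 < c₁ ∧ 0 < c₃ ∧
      ∀ {Ω ι : Type*} [MeasurableSpace Ω] [Fintype ι] {μ : Measure Ω} [IsProbabilityMeasure μ]
        {d : ℕ} {V : ι → Ω → Coef d}, (∀ k, Measurable (V k)) → iIndepFun V μ →
        (∀ k, SubGaussianVec K (V k) μ) → (∀ k, (secondMoment (V k) μ - α • 1).PosSemidef) →
        c₁ * (d : ℝ) ≤ Fintype.card ι →
        ∃ E, MeasurableSet E ∧ 1 - Real.exp (-(d : ℝ)) ≤ μ.real E ∧
          1 - Real.exp (-(c₃ * Fintype.card ι)) ≤ μ.real E ∧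
          ∀ ω ∈ E, ∀ v, Fintype.card ι * (α / 2) * ‖v‖ ^ 2 ≤ ∑ k, inner ℝ (V k ω) v ^ 2 := by
  obtain ⟨c, hc⟩ : ∃ c, c = α ^ 2 / (128 * K ^ 4) := ⟨_, rfl⟩
  have hc0 : 0 < c := hc ▸ by positivity
  obtain ⟨ε, hε0, hε, hgap⟩ := exists_sqrt_add_two_mul_sqrt_mul_le (a := α / 2) (b := 3 / 4 * α)
    (by positivity) (by linarith) (K ^ 2 * (Real.log 2 + c))
  have hlog : 0 ≤ Real.log (2 * (1 + 2 / ε)) :=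
    Real.log_nonneg (by linarith [show (0 : ℝ) ≤ 2 / ε by positivity])
  refine ⟨(Real.log (2 * (1 + 2 / ε)) + 1) / (c / 2), c / 2, by positivity, by positivity, ?_⟩
  intro Ω ι _ _ μ _ d V hV hind hsub hpsd hcard
  rcases eq_or_ne d 0 with rfl | hd
  · exact ⟨Set.univ, MeasurableSet.univ, by simp, by simp [Real.exp_nonneg],
      fun ω _ v => by simp [Subsingleton.elim v 0]⟩
  rw [div_mul_eq_mul_div, div_le_iff₀' (by positivity)] at hcard
  obtain ⟨S, hS, hcover, hScard⟩ := exists_isCover_sphere_card_le (Coef d) hε0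
  rw [finrank_euclideanSpace_fin] at hScard
  obtain ⟨E, hE, hprob, hnet⟩ :=
    exists_event_forall_mem_sum_inner_sq_bounds hK hV hind hsub hα.le hpsd hc hS
  have hfail : S.card * (2 * Real.exp (-(c * Fintype.card ι)))
      ≤ Real.exp (-(c / 2 * Fintype.card ι)) := by
    rw [← mul_div_right_comm]
    exact (mul_le_mul_of_nonneg_right hScard (by positivity)).trans
      (pow_mul_two_mul_exp_neg_le (by positivity) hd (by linarith [d.cast_nonneg (α := ℝ)]))
  have hE' := (sub_le_sub_left hfail 1).trans hprob
  refine ⟨E, hE, hE'.trans' (sub_le_sub_left (Real.exp_le_exp.2 ?_) 1), hE', fun ω hω v => ?_⟩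
  · linarith [mul_nonneg hlog (d.cast_nonneg (α := ℝ))]
  · refine mul_norm_sq_le_sum_inner_sq_of_isCover_sphere hε hcover ?_ (hnet ω hω) v
    simp only [Real.sqrt_mul (Nat.cast_nonneg (Fintype.card ι))]
    linarith [mul_le_mul_of_nonneg_left hgap (Real.sqrt_nonneg (Fintype.card ι))]

lemma card_sigma_eq_total {M : ℕ} (n : Fin M → ℕ) : Fintype.card (Σ i, Fin (n i)) = total n := by
  simp [total]

end FedLearn

theorem mainTheorem6 (α β K : ℝ) (hα : 0 < α) (hβ : 0 < β) (hK : 0 < K) :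
    ∃ c₁ c₂ c₃ : ℝ, 0 < c₁ ∧ 0 < c₂ ∧ 0 < c₃ ∧
      ∀ {Ω 𝒳 : Type*} [MeasurableSpace Ω] (μ : Measure Ω) [IsProbabilityMeasure μ]
        (d M : ℕ) (n : Fin M → ℕ) (φ : 𝒳 → FedLearn.Coef d)
        (x : ∀ i, Fin (n i) → Ω → 𝒳) (θs : Fin M → FedLearn.Coef d),
        (∀ i, 0 < n i) →
        (∀ i j, Measurable fun ω => φ (x i j ω)) →
        iIndepFun (fun (k : Σ i, Fin (n i)) (ω : Ω) => φ (x k.1 k.2 ω)) μ →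
        (∀ i j, FedLearn.SubGaussianVec K (fun ω => φ (x i j ω)) μ) →
        (∀ i j,
          (FedLearn.secondMoment (fun ω => φ (x i j ω)) μ - α • 1).PosSemidef ∧
          (β • 1 - FedLearn.secondMoment (fun ω => φ (x i j ω)) μ).PosSemidef) →
        c₁ * (d : ℝ) ≤ (FedLearn.total n : ℝ) →
        ∃ E E' : Set Ω, MeasurableSet E ∧ MeasurableSet E' ∧
          1 - Real.exp (-(d : ℝ)) ≤ μ.real E ∧
          1 - Real.exp (-(c₃ * (FedLearn.total n : ℝ))) ≤ μ.real E ∧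
          1 - Real.exp (-(FedLearn.total n : ℝ)) ≤ μ.real E' ∧
          ∀ ω ∈ E, ∀ (alg : FedLearn.FLAlgorithm) (η : ℝ), 1 ≤ alg.steps → 0 < η →
            ((∃ s, alg = FedLearn.FLAlgorithm.fedAvg s) →
              FedLearn.gam η φ (fun i j => x i j ω) < 1) →
            IsUnit (1 - FedLearn.roundOp alg η φ (fun i j => x i j ω)) ∧
            (∀ (σ : ℝ) (ν : Measure (∀ i, Fin (n i) → ℝ)), FedLearn.IsNoiseLaw σ ν →
              ∀ (θ₀ : FedLearn.Coef d) (t : ℕ),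
                Integrable (fun z =>
                  ‖FedLearn.globalModel alg η φ (fun i j => x i j ω)
                      (FedLearn.response φ (fun i j => x i j ω) θs z) θ₀ t
                    - FedLearn.thetaBar alg η φ (fun i j => x i j ω) θs‖ ^ 2) ν ∧
                ∫ z, ‖FedLearn.globalModel alg η φ (fun i j => x i j ω)
                      (FedLearn.response φ (fun i j => x i j ω) θs z) θ₀ t
                    - FedLearn.thetaBar alg η φ (fun i j => x i j ω) θs‖ ^ 2 ∂ν
                  ≤ (1 - (alg.steps : ℝ) * η * α
                        / (2 * FedLearn.kap alg η φ (fun i j => x i j ω))) ^ (2 * t)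
                      * ‖θ₀ - FedLearn.thetaBar alg η φ (fun i j => x i j ω) θs‖ ^ 2
                    + σ ^ 2 * (2 * FedLearn.kap alg η φ (fun i j => x i j ω) * (d : ℝ)
                        / ((FedLearn.total n : ℝ) * α))) ∧
            (ω ∈ E' → ∀ j,
              ‖FedLearn.thetaBar alg η φ (fun i j => x i j ω) θs - θs j‖
                ≤ c₂ * FedLearn.heterogeneity θs
                    * Real.sqrt (FedLearn.kap alg η φ (fun i j => x i j ω))) := by
  obtain ⟨c₁, c₃, hc₁, hc₃, hlower⟩ :=
    FedLearn.exists_event_card_mul_norm_sq_le_sum_inner_sq hα hK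
  refine ⟨c₁, √(K ^ 2 * (Real.log 2 + 1) / (α / 2)) + 1, c₃, hc₁, by positivity, hc₃, ?_⟩
  intro Ω 𝒳 _ μ _ d M n φ x θs _ hmeas hind hsub hmom hd
  have hG := FedLearn.heterogeneity_nonneg θs
  obtain ⟨θ, hθ⟩ := FedLearn.exists_norm_sub_le_heterogeneity θs
  let V (k : Σ i, Fin (n i)) (ω : Ω) := φ (x k.1 k.2 ω)
  obtain ⟨E, hE, hEd, hEN, hlow⟩ := hlower (V := V) (fun k => hmeas k.1 k.2) hind
    (fun k => hsub k.1 k.2) (fun k => (hmom k.1 k.2).1) (by rwa [FedLearn.card_sigma_eq_total])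
  obtain ⟨E', hE', hEN', hsum⟩ := FedLearn.exists_event_sum_inner_sq_le (V := V) hK
    (fun k => hmeas k.1 k.2) hind (fun k => hsub k.1 k.2) hG fun k => hθ k.1
  simp only [FedLearn.card_sigma_eq_total, Fintype.sum_sigma] at hEN hlow hEN' hsum
  refine ⟨E, E', hE, hE', hEd, hEN, hEN', fun ω hω alg η hs hη hadm => ?_⟩
  rcases d.eq_zero_or_pos with rfl | hd0
  · exact ⟨isUnit_of_subsingleton _, by simp [norm_of_subsingleton],
      fun _ j => by rw [norm_of_subsingleton]; positivity⟩
  have hN : FedLearn.total n ≠ 0 :=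
    Nat.cast_ne_zero.1 ((by positivity : 0 < c₁ * (d : ℝ)).trans_le hd).ne'
  have hC : (α / 2) • 1 ≤ FedLearn.pooledCovOp φ fun i j => x i j ω :=
    FedLearn.smul_one_le_pooledCovOp hN (hlow ω hω)
  have hγ := FedLearn.gam_pos hη hN hd0 (half_pos hα) hC
  have hu := FedLearn.isUnit_one_sub_roundOp hη hs hN hγ hadm hC (half_pos hα)
  refine ⟨hu, fun σ ν hν θ₀ t =>
    ⟨FedLearn.integrable_norm_globalModel_sub_thetaBar_sq hη hu hν θs θ₀ t, ?_⟩, fun hω' j => ?_⟩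
  · exact (FedLearn.integral_norm_globalModel_sub_thetaBar_sq_le_kap hη hs hN hγ hadm hC
      (half_pos hα) hν θs θ₀ t).trans_eq (by ring)
  · exact FedLearn.norm_thetaBar_sub_le hη hs hN hγ hadm hC (half_pos hα) θs (by positivity) hG hθ
      (hsum ω hω') j
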